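/- Let $\mathbf k$ be an algebraically closed field of characteristic $0$, $R$ a commutative unital $\mathbf k$-algebra, $(\mathfrak g,[-,-]_{\mathfrak g},\rhd)$ a post-Lie algebra over $\mathbf k$, i.e. a Lie algebra with a bilinear product such that $$x\rhd[y,z]=[x\rhd y,z]+[y,x\rhd z],\qquad ([x,y]+x\rhd y-y\rhd x)\rhd z=x\rhd(y\rhd z)-y\rhd(x\rhd z),$$ and $\mathfrak g_\rhd$ its sub-adjacent Lie algebra, with bracket $[x,y]_\rhd=x\rhd y-y\rhd x+[x,y]_{\mathfrak g}$. Let $\rho:\mathfrak g_\rhd\to\mathrm{Der}(R)$ be a Lie algebra homomorphism, and let $L=R\otimes\mathfrak g$ be the action post-Lie-Rinehart algebra, with $$[fx,gy]_L=fg[x,y]_{\mathfrak g},\quad fx\,\overline\rhd\,gy=f\rho(x)(g)\,y+fg\,(x\rhd y),\quad \overline\rho(fx)(g)=f\rho(x)(g)\qquad(f,g\in R,\ x,y\in\mathfrak g).$$ *Notions.* A weak post-Hopf algebroid over $R$ is a cocommutative Hopf $R$-algebra $H$ (with $\iota:R\to Z(H)$) with a $\mathbf k$-bilinear product $\rhd$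 such that $\Delta(x\rhd y)=(x_1\rhd y_1)\otimes_R(x_2\rhd y_2)$, $x\rhd 1=\iota(\varepsilon(x))$, $1\rhd x=x$, $\iota(\varepsilon(x\rhd y))=x\rhd\iota(\varepsilon(y))$, $fx\rhd y=f(x\rhd y)$, $x\rhd yz=(x_1\rhd y)(x_2\rhd z)$ and $x\rhd(y\rhd z)=\big(x_1(x_2\rhd y)\big)\rhd z$ for $f\in R$, $x,y,z\in H$. Its Grossman-Larson product is $x*y=x_1(x_2\rhd y)$. It is a post-Hopf algebroid if there is a $\mathbf k$-linear anti-automorphism $\theta$ of $(H,*)$ with $\theta\iota=\iota$, $\Delta(\theta(x))=\theta(x_1)\otimes_R\theta(x_2)$, $x_1*\theta(x_2)=\iota(\varepsilon(x))$ and $\theta(x_1)*x_2=\iota(\varepsilon(\theta(x)))$; in the first two of the last three identities $x_1\otimes x_2$ stands for $\gamma(\Delta(x))$, where $\gamma$ is some $\mathbf k$-linear section of the projection $H\otimes_{\mathbf k}H\to H\otimes_RH$. Isomorphisms of post-Hopf algebroids are isomorphisms of Hopf $R$-algebras compatible with $\rhd$ and $\theta$. A post-Hopf algebra over $\mathbf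 k$ is a Hopf algebra $A$ with a coalgebra homomorphism $\rhd:A\otimes A\to A$ satisfying the last two identities of a weak post-Hopf algebroid, for which $x\mapsto(x\rhd\cdot)$ has a convolution inverse $\beta:A\to\mathrm{End}(A)$; put $x*y=x_1(x_2\rhd y)$ and $S_\rhd(x)=\beta_{x_1}(S(x_2))$. *Claim.* 1. On the universal enveloping algebra $\mathscr U(\mathfrak g)$, with its usual Hopf algebra structure, there is a unique bilinear product $\rhd$ extending that of $\mathfrak g$ such that $c\rhd X=cX$, $x\rhd c=0$, $x\rhd yX=(x\rhd y)X+y(x\rhd X)$ and $xX\rhd Y=x\rhd(X\rhd Y)-(x\rhd X)\rhd Y$ for $c\in\mathbf k$, $x,y\in\mathfrak g$, $X,Y\in\mathscr U(\mathfrak g)$. It makes $\mathscr U(\mathfrak g)$ a post-Hopf algebra. There is an isomorphism of coalgebras $\Phi:\mathscr U(\mathfrak g_\rhd)\to\mathscr U(\mathfrak g)$ which is the identity on $\mathfrak g$ and satisfies $\Phi(1)=1$, $\Phi(XY)=\Phi(X)*\Phi(Y)$. Through $\Phi^{-1}$ the lift of $\rho$ to $\mathscr U(\mathfrak g_\rhd)$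 gives an action $\rightharpoonup$ making $R$ a module algebra over the bialgebra $(\mathscr U(\mathfrak g),*,1,\Delta,\varepsilon)$. 2. The tensor product Hopf $R$-algebra $R\otimes\mathscr U(\mathfrak g)$ is a post-Hopf algebroid over $R$ (the action post-Hopf algebroid) with $$fa\,\overline\rhd\,gb=f(a_1\rightharpoonup g)(a_2\rhd b),\qquad \theta(fa)=(S_\rhd(a_1)\rightharpoonup f)\,S_\rhd(a_2).$$ 3. Let $\mathscr U_R(L)$ be the universal enveloping algebra of the Lie $R$-algebra $(L,[-,-]_L)$, with its usual Hopf $R$-algebra structure (elements of $L$ are primitive). There is a unique $\mathbf k$-bilinear product $\overline\rhd$ on $\mathscr U_R(L)$ extending that of $L$ such that $$f\,\overline\rhd\,X=fX,\quad x\,\overline\rhd\,f=\overline\rho(x)(f),\quad x\,\overline\rhd\,yX=(x\,\overline\rhd\,y)X+y(x\,\overline\rhd\,X),\quad xX\,\overline\rhd\,Y=x\,\overline\rhd\,(X\,\overline\rhd\,Y)-(x\,\overline\rhd\,X)\,\overline\rhd\,Y$$ for $f\in R$, $x,y\in L$, $X,Y\in\mathscr U_R(L)$. With this product and a suitable $\theta$,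 $\mathscr U_R(L)$ is a post-Hopf algebroid over $R$, and it is isomorphic to the action post-Hopf algebroid $R\otimes\mathscr U(\mathfrak g)$ by an isomorphism that maps $1\otimes x$ to the class of $1\otimes x\in L$ for every $x\in\mathfrak g$. -/

import Mathlib

open scoped TensorProduct
open UniversalEnvelopingAlgebra (ι)

attribute [local instance 100] LieRing.ofAssociativeRing

noncomputable section

/-! ### The Hopf algebra structure of a universal enveloping algebra -/

namespace UniversalEnvelopingAlgebra

variable (R : Type*) {L : Type*} [CommRing R] [LieRing L] [LieAlgebra R L]

theorem adjoin_range_ι :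
    Algebra.adjoin R (Set.range (ι R : L → UniversalEnvelopingAlgebra R L)) = ⊤ := by
  set S := Algebra.adjoin R (Set.range (ι R : L → UniversalEnvelopingAlgebra R L)) with hS
  let f : L →ₗ⁅R⁆ S :=
    { toFun := fun x => ⟨ι R x, Algebra.subset_adjoin ⟨x, rfl⟩⟩
      map_add' := fun x y => Subtype.ext (map_add (ι R) x y)
      map_smul' := fun c x => Subtype.ext (map_smul (ι R) c x)
      map_lie' := fun {x y} => Subtype.ext (LieHom.map_lie (ι R) x y) }
  have h : S.val.comp (lift R f) = AlgHom.id R _ := by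
    apply hom_ext
    ext x
    show S.val (lift R f (ι R x)) = ι R x
    rw [lift_ι_apply]
    rfl
  rw [eq_top_iff]
  intro x _
  have := DFunLike.congr_fun h x
  simp only [AlgHom.comp_apply, AlgHom.id_apply] at this
  rw [← this]
  exact (lift R f x).2

variable {R} in
/-- Induction on words: scalars, sums, and left multiplication by a generator. -/
theorem word_induction {p : UniversalEnvelopingAlgebra R L → Prop}
    (scalar : ∀ r, p (algebraMap R _ r)) (add : ∀ a b, p a → p b → p (a + b))
    (mul : ∀ x a, p a → p (ι R x * a)) (a : UniversalEnvelopingAlgebra R L) : p a := by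
  have smul : ∀ (r : R) b, p b → p (algebraMap R _ r * b) := by
    intro r b hb
    have key : ∀ c : UniversalEnvelopingAlgebra R L, (∀ r : R, p (algebraMap R _ r * c)) →
        ∀ x : L, ∀ r : R, p (algebraMap R _ r * (ι R x * c)) := by
      intro c hc x r
      rw [← mul_assoc, Algebra.commutes, mul_assoc]
      exact mul x _ (hc r)
    have all : ∀ (d : UniversalEnvelopingAlgebra R L), ∀ c, (∀ r : R, p (algebraMap R _ r * c)) →
        ∀ r : R, p (algebraMap R _ r * (d * c)) := by
      intro d
      have hd : d ∈ Algebra.adjoin R (Set.range (ι R : L → UniversalEnvelopingAlgebra R L)) := by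
        rw [adjoin_range_ι]; trivial
      induction hd using Algebra.adjoin_induction with
      | mem d h => obtain ⟨x, rfl⟩ := h; intro c hc; exact key c hc x
      | algebraMap s => intro c hc r; rw [← mul_assoc, ← map_mul]; exact hc _
      | add d e _ _ h1 h2 =>
        intro c hc r; rw [add_mul, mul_add]; exact add _ _ (h1 c hc r) (h2 c hc r)
      | mul d e _ _ h1 h2 => intro c hc r; rw [mul_assoc]; exact h1 _ (h2 c hc) r
    have := all b 1 (fun r => by rw [mul_one]; exact scalar r) r
    rwa [mul_one] at this
  have all : ∀ d : UniversalEnvelopingAlgebra R L, ∀ c, p c → p (d * c) := by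
    intro d
    have hd : d ∈ Algebra.adjoin R (Set.range (ι R : L → UniversalEnvelopingAlgebra R L)) := by
      rw [adjoin_range_ι]; trivial
    induction hd using Algebra.adjoin_induction with
    | mem d h => obtain ⟨x, rfl⟩ := h; exact mul x
    | algebraMap s => exact smul s
    | add d e _ _ h1 h2 => intro c hc; rw [add_mul]; exact add _ _ (h1 c hc) (h2 c hc)
    | mul d e _ _ h1 h2 => intro c hc; rw [mul_assoc]; exact h1 _ (h2 c hc)
  have := all a 1 (by simpa using scalar 1)
  rwa [mul_one] at this

/-- For a Lie `R`-algebra `L`, seen as a Lie-Rinehart algebra with zero anchor over the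
`k`-algebra `R`, the algebra `UniversalEnvelopingAlgebra R L` has the universal property of the
universal enveloping algebra of that Lie-Rinehart algebra. -/
theorem lieRinehart_universal {k : Type*} [CommRing k] [Algebra k R] [Module k L]
    [IsScalarTower k R L]
    [Algebra k (UniversalEnvelopingAlgebra R L)] [IsScalarTower k R (UniversalEnvelopingAlgebra R L)]
    {B : Type*} [Ring B] [Algebra k B] (κR : R →ₐ[k] B) (κL : L →ₗ[k] B)
    (hlie : ∀ x y, κL ⁅x, y⁆ = κL x * κL y - κL y * κL x)
    (hsmul : ∀ f x, κR f * κL x = κL (f • x))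
    (hcomm : ∀ f x, κL x * κR f - κR f * κL x = 0) :
    ∃! φ : UniversalEnvelopingAlgebra R L →ₐ[k] B,
      (∀ f, φ (algebraMap R _ f) = κR f) ∧ ∀ x, φ (ι R x) = κL x := by
  let C := Subalgebra.centralizer k (Set.range κR)
  have hRC : ∀ f, κR f ∈ C := by
    rintro f _ ⟨g, rfl⟩
    rw [← map_mul, ← map_mul, mul_comm]
  have hLC : ∀ x, κL x ∈ C := by
    rintro x _ ⟨g, rfl⟩
    exact (sub_eq_zero.1 (hcomm g x)).symm
  let κ' : R →+* C := (κR.codRestrict C hRC : R →ₐ[k] C)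
  let _ : Algebra R C := κ'.toAlgebra' (by
    rintro f ⟨c, hc⟩
    exact Subtype.ext (hc _ ⟨f, rfl⟩))
  let g : L →ₗ⁅R⁆ C :=
    { toFun := fun x => ⟨κL x, hLC x⟩
      map_add' := fun x y => Subtype.ext (map_add κL x y)
      map_smul' := fun f x => by
        rw [Algebra.smul_def]
        exact Subtype.ext (hsmul f x).symm
      map_lie' := fun {x y} => Subtype.ext (hlie x y) }
  have hk : ∀ c : k, algebraMap k (UniversalEnvelopingAlgebra R L) c =
      algebraMap R _ (algebraMap k R c) := fun c => IsScalarTower.algebraMap_apply _ _ _ _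
  let φ : UniversalEnvelopingAlgebra R L →ₐ[k] B :=
    { (C.val : C →+* B).comp (lift R g : UniversalEnvelopingAlgebra R L →+* C) with
      commutes' := fun c => by
        show ((lift R g (algebraMap k _ c) : C) : B) = _
        rw [hk, AlgHom.commutes]
        exact κR.commutes c }
  have hφR : ∀ f, φ (algebraMap R _ f) = κR f := by
    intro f
    show ((lift R g (algebraMap R _ f) : C) : B) = _
    rw [AlgHom.commutes]
    rfl
  have hφL : ∀ x, φ (ι R x) = κL x := by
    intro x
    show ((lift R g (ι R x) : C) : B) = _
    rw [lift_ι_apply]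
    rfl
  refine ⟨φ, ⟨hφR, hφL⟩, ?_⟩
  rintro ψ ⟨h1, h2⟩
  ext a
  induction a using word_induction with
  | scalar r => rw [h1, hφR]
  | add a b ha hb => rw [map_add, map_add, ha, hb]
  | mul x a ha => rw [map_mul, map_mul, ha, h2, hφL]

local notation "U" => UniversalEnvelopingAlgebra R L

/-- The coproduct, the algebra homomorphism with `x ↦ x ⊗ 1 + 1 ⊗ x` for `x` in `L`. -/
def comulHom : U →ₐ[R] U ⊗[R] U :=
  lift R
    { toFun := fun x => ι R x ⊗ₜ[R] (1 : U) + (1 : U) ⊗ₜ[R] ι R x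
      map_add' := fun x y => by
        simp only [map_add, TensorProduct.add_tmul, TensorProduct.tmul_add]; abel
      map_smul' := fun c x => by
        simp only [map_smul, TensorProduct.smul_tmul', TensorProduct.tmul_smul, smul_add,
          RingHom.id_apply]
      map_lie' := fun {x y} => by
        simp only [LieHom.map_lie, LieRing.of_associative_ring_bracket, mul_add, add_mul,
          Algebra.TensorProduct.tmul_mul_tmul, mul_one, one_mul, TensorProduct.sub_tmul,
          TensorProduct.tmul_sub]
        abel }

/-- The counit, the algebra homomorphism with `x ↦ 0` for `x` in `L`. -/
def counitHom : U →ₐ[R] R := lift R 0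

/-- The antipode as an algebra homomorphism to the opposite algebra, with `x ↦ -x` for `x` in
`L`. -/
def antipodeHom : U →ₐ[R] Uᵐᵒᵖ :=
  lift R
    { toFun := fun x => MulOpposite.op (-ι R x)
      map_add' := fun x y => by rw [map_add, neg_add, MulOpposite.op_add]
      map_smul' := fun c x => by rw [map_smul, ← smul_neg, MulOpposite.op_smul]; rfl
      map_lie' := fun {x y} => by
        simp only [LieHom.map_lie, LieRing.of_associative_ring_bracket, ← MulOpposite.op_mul,
          ← MulOpposite.op_sub]
        congr 1
        noncomm_ring }

@[simp] theorem comulHom_ι (x : L) :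
    comulHom R (ι R x) = ι R x ⊗ₜ[R] (1 : U) + (1 : U) ⊗ₜ[R] ι R x := lift_ι_apply R _ x

@[simp] theorem counitHom_ι (x : L) : counitHom R (ι R x) = 0 := lift_ι_apply R _ x

@[simp] theorem antipodeHom_ι (x : L) :
    antipodeHom R (ι R x) = MulOpposite.op (-ι R x) := lift_ι_apply R _ x

variable {R} in
theorem algHom_ext' {B : Type*} [Ring B] [Algebra R B] {f g : U →ₐ[R] B}
    (h : ∀ x, f (ι R x) = g (ι R x)) : f = g := by
  apply hom_ext
  ext x
  exact h x

instance : Bialgebra R U :=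
  Bialgebra.ofAlgHom (comulHom R) (counitHom R)
    (algHom_ext' fun x => by
      simp [-ι_apply, TensorProduct.add_tmul, TensorProduct.tmul_add,
        Algebra.TensorProduct.one_def, add_assoc])
    (algHom_ext' fun x => by simp [-ι_apply])
    (algHom_ext' fun x => by simp [-ι_apply])

/-- The antipode as a linear map. -/
def antipodeLin : U →ₗ[R] U :=
  (MulOpposite.opLinearEquiv R).symm.toLinearMap ∘ₗ (antipodeHom R).toLinearMap

theorem antipodeLin_ι (x : L) : antipodeLin R (ι R x) = -ι R x := by
  simp [-ι_apply, antipodeLin]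

theorem antipodeLin_algebraMap (r : R) :
    antipodeLin R (algebraMap R U r) = algebraMap R U r := by
  simp [antipodeLin]

theorem antipodeLin_mul (a b : U) :
    antipodeLin R (a * b) = antipodeLin R b * antipodeLin R a := by
  simp [antipodeLin]

theorem comul_eq (a : U) : Coalgebra.comul (R := R) a = comulHom R a := rfl

theorem counit_eq (a : U) : Coalgebra.counit (R := R) a = counitHom R a := rfl

instance : HopfAlgebra R U where
  antipode := antipodeLin R
  mul_antipode_rTensor_comul := by
    have key : ∀ (x : L) (z : U ⊗[R] U),
        LinearMap.mul' R U ((antipodeLin R).rTensor U (comulHom R (ι R x) * z)) = 0 := by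
      intro x z
      induction z with
      | zero => simp
      | add a b ha hb => rw [mul_add, map_add, map_add, ha, hb, add_zero]
      | tmul a b =>
        simp only [comulHom_ι, add_mul, Algebra.TensorProduct.tmul_mul_tmul, one_mul, map_add,
          LinearMap.rTensor_tmul, LinearMap.mul'_apply, antipodeLin_mul, antipodeLin_ι]
        noncomm_ring
    ext a
    show LinearMap.mul' R U ((antipodeLin R).rTensor U (comulHom R a)) =
      algebraMap R U (counitHom R a)
    induction a using word_induction with
    | scalar r =>
      rw [AlgHom.commutes, AlgHom.commutes, Algebra.TensorProduct.algebraMap_apply]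
      simp [antipodeLin_algebraMap]
    | add a b ha hb => simp only [map_add, ha, hb]
    | mul x a _ => rw [map_mul, key, map_mul, counitHom_ι, zero_mul, map_zero]
  mul_antipode_lTensor_comul := by
    have key : ∀ (x : L) (z : U ⊗[R] U),
        LinearMap.mul' R U ((antipodeLin R).lTensor U (comulHom R (ι R x) * z)) =
          ι R x * LinearMap.mul' R U ((antipodeLin R).lTensor U z) -
            LinearMap.mul' R U ((antipodeLin R).lTensor U z) * ι R x := by
      intro x z
      induction z with
      | zero => simp
      | add a b ha hb =>
        rw [mul_add, map_add, map_add, ha, hb, map_add, map_add]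
        noncomm_ring
      | tmul a b =>
        simp only [comulHom_ι, add_mul, Algebra.TensorProduct.tmul_mul_tmul, one_mul, map_add,
          LinearMap.lTensor_tmul, LinearMap.mul'_apply, antipodeLin_mul, antipodeLin_ι]
        noncomm_ring
    ext a
    show LinearMap.mul' R U ((antipodeLin R).lTensor U (comulHom R a)) =
      algebraMap R U (counitHom R a)
    induction a using word_induction with
    | scalar r =>
      rw [AlgHom.commutes, AlgHom.commutes, Algebra.TensorProduct.algebraMap_apply]
      simp
      simp [antipodeLin]
    | add a b ha hb => simp only [map_add, ha, hb]
    | mul x a ha =>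
      rw [map_mul, key, ha, map_mul, counitHom_ι, zero_mul, map_zero, Algebra.commutes, sub_self]

end UniversalEnvelopingAlgebra

/-- For the base change `R ⊗ g` of a Lie `k`-algebra, the `R`-algebra `U_R(R ⊗ g)` is a
`k`-algebra by restriction of scalars. -/
instance UniversalEnvelopingAlgebra.algebraOfBaseChange (k R g : Type*) [CommRing k] [CommRing R]
    [Algebra k R] [LieRing g] [LieAlgebra k g] :
    Algebra k (UniversalEnvelopingAlgebra R (R ⊗[k] g)) :=
  Algebra.compHom _ (algebraMap k R)

instance UniversalEnvelopingAlgebra.isScalarTower_baseChange (k R g : Type*) [CommRing k]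
    [CommRing R] [Algebra k R] [LieRing g] [LieAlgebra k g] :
    IsScalarTower k R (UniversalEnvelopingAlgebra R (R ⊗[k] g)) :=
  IsScalarTower.of_algebraMap_eq fun _ => rfl

/-! ### Post-Lie algebras and post-Lie-Rinehart algebras -/

/-- A post-Lie algebra structure on a Lie algebra `g` over `k`. -/
structure PostLieAlgebra (k g : Type*) [CommRing k] [LieRing g] [LieAlgebra k g] where
  /-- the post-Lie product `x ▷ y` -/
  tri : g →ₗ[k] g →ₗ[k] g
  tri_lie : ∀ x y z, tri x ⁅y, z⁆ = ⁅tri x y, z⁆ + ⁅y, tri x z⁆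
  lie_tri : ∀ x y z,
    tri (⁅x, y⁆ + tri x y - tri y x) z = tri x (tri y z) - tri y (tri x z)

namespace PostLieAlgebra

variable {k g : Type*} [CommRing k] [LieRing g] [LieAlgebra k g] (P : PostLieAlgebra k g)

/-- The sub-adjacent Lie algebra: `g` with the bracket `x ▷ y - y ▷ x + [x, y]`. -/
def SubAdjacent (_ : PostLieAlgebra k g) : Type _ := g

instance : AddCommGroup P.SubAdjacent := inferInstanceAs (AddCommGroup g)

instance : Module k P.SubAdjacent := inferInstanceAs (Module k g)

/-- The identity map from the sub-adjacent Lie algebra to `g`. -/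
def ofSub : P.SubAdjacent ≃ₗ[k] g := LinearEquiv.refl k g

instance : Bracket P.SubAdjacent P.SubAdjacent where
  bracket x y := P.ofSub.symm
    (P.tri (P.ofSub x) (P.ofSub y) - P.tri (P.ofSub y) (P.ofSub x) + ⁅P.ofSub x, P.ofSub y⁆)

theorem ofSub_lie (x y : P.SubAdjacent) : P.ofSub ⁅x, y⁆ =
    P.tri (P.ofSub x) (P.ofSub y) - P.tri (P.ofSub y) (P.ofSub x) + ⁅P.ofSub x, P.ofSub y⁆ := rfl

instance : LieRing P.SubAdjacent where
  add_lie x y z := by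
    apply P.ofSub.injective
    simp only [map_add, ofSub_lie, LinearMap.add_apply, add_lie]
    abel
  lie_add x y z := by
    apply P.ofSub.injective
    simp only [map_add, ofSub_lie, LinearMap.add_apply, lie_add]
    abel
  lie_self x := by
    apply P.ofSub.injective
    simp [ofSub_lie]
  leibniz_lie x y z := by
    apply P.ofSub.injective
    simp only [map_add, ofSub_lie]
    generalize P.ofSub x = a, P.ofSub y = b, P.ofSub z = c
    have h1 := P.lie_tri a b c
    have h2 := P.lie_tri a c b
    have h3 := P.lie_tri b c a
    simp only [map_add, map_sub, LinearMap.add_apply, LinearMap.sub_apply, lie_add, lie_sub,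
      add_lie, sub_lie, P.tri_lie] at h1 h2 h3 ⊢
    have h4 := leibniz_lie a b c
    have e1 : ⁅P.tri c a, b⁆ = -⁅b, P.tri c a⁆ := (lie_skew _ _).symm
    have e2 : ⁅P.tri a b, c⁆ = -⁅c, P.tri a b⁆ := (lie_skew _ _).symm
    have e3 : ⁅P.tri b a, c⁆ = -⁅c, P.tri b a⁆ := (lie_skew _ _).symm
    have e4 : ⁅P.tri b c, a⁆ = -⁅a, P.tri b c⁆ := (lie_skew _ _).symm
    have e5 : ⁅P.tri c b, a⁆ = -⁅a, P.tri c b⁆ := (lie_skew _ _).symm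
    have e6 : ⁅P.tri a c, b⁆ = -⁅b, P.tri a c⁆ := (lie_skew _ _).symm
    grind

instance : LieAlgebra k P.SubAdjacent where
  lie_smul c x y := by
    apply P.ofSub.injective
    simp only [map_smul, ofSub_lie, LinearMap.smul_apply, lie_smul, smul_add, smul_sub]

end PostLieAlgebra

/-- A post-Lie-Rinehart algebra `(R, L, [-,-], ρ, ▷)` on a Lie `R`-algebra `L`, where `R` is a
commutative `k`-algebra. -/
structure PostLieRinehart (k R L : Type*) [CommRing k] [CommRing R] [Algebra k R]
    [LieRing L] [LieAlgebra R L] [Module k L] [IsScalarTower k R L] where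
  /-- the post-Lie product, `R`-linear in the first argument -/
  tri : L →ₗ[R] (L →ₗ[k] L)
  /-- the anchor `ρ` -/
  anchor : L →ₗ[R] Derivation k R R
  tri_lie : ∀ x y z, tri x ⁅y, z⁆ = ⁅tri x y, z⁆ + ⁅y, tri x z⁆
  lie_tri : ∀ x y z,
    tri (⁅x, y⁆ + tri x y - tri y x) z = tri x (tri y z) - tri y (tri x z)
  anchor_lie : ∀ x y, anchor (tri x y - tri y x + ⁅x, y⁆) = ⁅anchor x, anchor y⁆
  tri_smul : ∀ (x : L) (f : R) (y : L), tri x (f • y) = f • tri x y + anchor x f • y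

/-- A post-Lie algebra over `k` is a post-Lie-Rinehart algebra over `R = k` with zero anchor. -/
def PostLieAlgebra.toPostLieRinehart {k g : Type*} [CommRing k] [LieRing g] [LieAlgebra k g]
    (P : PostLieAlgebra k g) : PostLieRinehart k k g where
  tri := P.tri
  anchor := 0
  tri_lie := P.tri_lie
  lie_tri := P.lie_tri
  anchor_lie := fun x y => by simp
  tri_smul := fun x f y => by simp

/-! ### The action post-Lie-Rinehart algebra `R ⊗ g` -/

section Action

variable {k R g : Type*} [CommRing k] [CommRing R] [Algebra k R] [LieRing g] [LieAlgebra k g]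
  (P : PostLieAlgebra k g) (ρ : P.SubAdjacent →ₗ⁅k⁆ Derivation k R R)

/-- The post-Lie product of `R ⊗ g`,
`(f₁ ⊗ x₁) ▷ (f₂ ⊗ x₂) = f₁ ρ(x₁)(f₂) ⊗ x₂ + f₁ f₂ ⊗ (x₁ ▷ x₂)`. -/
def actionTri : R ⊗[k] g →ₗ[R] (R ⊗[k] g →ₗ[k] R ⊗[k] g) :=
  LinearMap.liftBaseChange R
    { toFun := fun x =>
        LinearMap.rTensor g (ρ (P.ofSub.symm x) : R →ₗ[k] R) + LinearMap.lTensor R (P.tri x)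
      map_add' := fun x y => by
        simp only [map_add, Derivation.coe_add_linearMap, LinearMap.rTensor_add,
          LinearMap.lTensor_add]
        abel
      map_smul' := fun c x => by
        simp only [map_smul, Derivation.coe_smul_linearMap, LinearMap.rTensor_smul,
          LinearMap.lTensor_smul, RingHom.id_apply, smul_add] }

theorem actionTri_tmul (f₁ f₂ : R) (x₁ x₂ : g) :
    actionTri P ρ (f₁ ⊗ₜ x₁) (f₂ ⊗ₜ x₂) =
      (f₁ * ρ (P.ofSub.symm x₁) f₂) ⊗ₜ x₂ + (f₁ * f₂) ⊗ₜ P.tri x₁ x₂ := by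
  simp [actionTri, TensorProduct.smul_tmul', smul_add]

/-- The anchor of `R ⊗ g`, `(f ⊗ x) ↦ f ρ(x)`. -/
def actionAnchor : R ⊗[k] g →ₗ[R] Derivation k R R :=
  LinearMap.liftBaseChange R ((ρ : P.SubAdjacent →ₗ[k] Derivation k R R) ∘ₗ P.ofSub.symm.toLinearMap)

theorem actionAnchor_tmul (f f' : R) (x : g) :
    actionAnchor P ρ (f ⊗ₜ x) f' = f * ρ (P.ofSub.symm x) f' := by
  simp [actionAnchor]

theorem rho_sub (x y : g) (f : R) :
    ρ (P.ofSub.symm (P.tri x y)) f - ρ (P.ofSub.symm (P.tri y x)) f + ρ (P.ofSub.symm ⁅x, y⁆) f =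
      ρ (P.ofSub.symm x) (ρ (P.ofSub.symm y) f) - ρ (P.ofSub.symm y) (ρ (P.ofSub.symm x) f) := by
  have h := LieHom.map_lie ρ (P.ofSub.symm x) (P.ofSub.symm y)
  rw [← Derivation.commutator_apply, ← h, show ⁅P.ofSub.symm x, P.ofSub.symm y⁆ =
    P.ofSub.symm (P.tri x y - P.tri y x + ⁅x, y⁆) from rfl]
  simp

/-- The action post-Lie-Rinehart algebra on `R ⊗ g`, with the `R`-bilinear extension of the
bracket of `g` as its bracket. -/
def actionPostLieRinehart : PostLieRinehart k R (R ⊗[k] g) where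
  tri := actionTri P ρ
  anchor := actionAnchor P ρ
  tri_lie x y z := by
    induction x with
    | zero => simp
    | add x x' hx hx' => simp only [map_add, LinearMap.add_apply, hx, hx', add_lie, lie_add]; abel
    | tmul a x =>
      induction y with
      | zero => simp
      | add y y' hy hy' => simp only [map_add, hy, hy', add_lie]; abel
      | tmul b y =>
        induction z with
        | zero => simp
        | add z z' hz hz' => simp only [map_add, hz, hz', lie_add]; abel
        | tmul c z =>
          simp only [LieAlgebra.ExtendScalars.bracket_tmul, actionTri_tmul, add_lie, lie_add,
            P.tri_lie, Derivation.leibniz, smul_eq_mul, TensorProduct.tmul_add]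
          rw [mul_add, TensorProduct.add_tmul,
            show a * (b * c) = a * b * c by ring, show a * (b * ρ (P.ofSub.symm x) c) =
              b * (a * ρ (P.ofSub.symm x) c) by ring,
            show a * (c * ρ (P.ofSub.symm x) b) = a * ρ (P.ofSub.symm x) b * c by ring,
            show b * (a * c) = a * b * c by ring]
          abel
  lie_tri x y z := by
    induction x with
    | zero => simp
    | add x x' hx hx' =>
      have : ⁅x + x', y⁆ + actionTri P ρ (x + x') y - actionTri P ρ y (x + x') =
        (⁅x, y⁆ + actionTri P ρ x y - actionTri P ρ y x) +
          (⁅x', y⁆ + actionTri P ρ x' y - actionTri P ρ y x') := by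
        simp only [map_add, LinearMap.add_apply, add_lie]; abel
      rw [this, map_add, LinearMap.add_apply, hx, hx']
      simp only [map_add, LinearMap.add_apply]; abel
    | tmul a x =>
      induction y with
      | zero => simp
      | add y y' hy hy' =>
        have : ⁅a ⊗ₜ[k] x, y + y'⁆ + actionTri P ρ (a ⊗ₜ[k] x) (y + y') -
            actionTri P ρ (y + y') (a ⊗ₜ x) =
          (⁅a ⊗ₜ[k] x, y⁆ + actionTri P ρ (a ⊗ₜ[k] x) y - actionTri P ρ y (a ⊗ₜ x)) +
            (⁅a ⊗ₜ[k] x, y'⁆ + actionTri P ρ (a ⊗ₜ[k] x) y' - actionTri P ρ y' (a ⊗ₜ x)) := by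
          simp only [map_add, LinearMap.add_apply, lie_add]; abel
        rw [this, map_add, LinearMap.add_apply, hy, hy']
        simp only [map_add, LinearMap.add_apply]; abel
      | tmul b y =>
        induction z with
        | zero => simp
        | add z z' hz hz' => simp only [map_add, hz, hz']; abel
        | tmul c z =>
          have h := P.lie_tri x y z
          have h' := rho_sub P ρ x y c
          have e1 : P.tri ⁅x, y⁆ z = P.tri x (P.tri y z) - P.tri y (P.tri x z)
              - P.tri (P.tri x y) z + P.tri (P.tri y x) z := by
            simp only [map_add, map_sub, LinearMap.add_apply, LinearMap.sub_apply] at h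
            rw [← h]; abel
          have e2 : ρ (P.ofSub.symm ⁅x, y⁆) c =
              ρ (P.ofSub.symm x) (ρ (P.ofSub.symm y) c)
              - ρ (P.ofSub.symm y) (ρ (P.ofSub.symm x) c)
              - ρ (P.ofSub.symm (P.tri x y)) c + ρ (P.ofSub.symm (P.tri y x)) c := by
            rw [← h']; ring
          simp only [LieAlgebra.ExtendScalars.bracket_tmul, actionTri_tmul, map_add, map_sub,
            LinearMap.add_apply, LinearMap.sub_apply, Derivation.leibniz, smul_eq_mul, e1, e2]
          simp only [TensorProduct.tmul_add, TensorProduct.tmul_sub, TensorProduct.add_tmul,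
            TensorProduct.sub_tmul, mul_add, mul_sub]
          ring_nf
          abel
  anchor_lie x y := by
    ext f
    rw [Derivation.commutator_apply]
    induction x with
    | zero => simp
    | add x x' hx hx' =>
      simp only [map_add, map_sub, LinearMap.add_apply, Derivation.add_apply,
        Derivation.sub_apply, add_lie] at hx hx' ⊢
      linear_combination hx + hx'
    | tmul a x =>
      induction y with
      | zero => simp
      | add y y' hy hy' =>
        simp only [map_add, map_sub, LinearMap.add_apply, Derivation.add_apply,
          Derivation.sub_apply, lie_add] at hy hy' ⊢
        linear_combination hy + hy'
      | tmul b y =>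
        have h' := rho_sub P ρ x y f
        simp only [LieAlgebra.ExtendScalars.bracket_tmul, actionTri_tmul, map_add, map_sub,
          Derivation.add_apply, Derivation.sub_apply, actionAnchor_tmul, Derivation.leibniz,
          smul_eq_mul]
        linear_combination a * b * h'
  tri_smul x f y := by
    induction x with
    | zero => simp
    | add x x' hx hx' =>
      simp only [map_add, LinearMap.add_apply, hx, hx', Derivation.add_apply, add_smul, smul_add]
      abel
    | tmul a x =>
      induction y with
      | zero => simp
      | add y y' hy hy' => simp only [map_add, smul_add, hy, hy']; abel
      | tmul b y =>
        simp only [TensorProduct.smul_tmul', actionTri_tmul, actionAnchor_tmul, smul_eq_mul,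
          Derivation.leibniz, mul_add, TensorProduct.add_tmul, smul_add]
        ring_nf
        abel

end Action

/-! ### Post-Hopf algebras -/

/-- A finite Sweedler decomposition `Δ(x) = ∑ᵢ x₁ⁱ ⊗ x₂ⁱ`. -/
abbrev Sweedler (R : Type*) {H : Type*} [CommSemiring R] [AddCommMonoid H] [Module R H]
    [CoalgebraStruct R H] (x : H) := Coalgebra.Repr R x ℕ

open Coalgebra (comul counit)
open HopfAlgebra (antipode)

/-- A post-Hopf algebra structure on a Hopf algebra `A` over `k`: a coalgebra homomorphism
`▷ : A ⊗ A → A` with the two compatibilities below whose left multiplication `α : A → End(A)` has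
a convolution inverse `β : A → End(A)` (which is then unique). -/
structure PostHopfAlgebra (k A : Type*) [CommRing k] [Ring A] [HopfAlgebra k A] where
  /-- the product `x ▷ y` -/
  tri : A →ₗ[k] A →ₗ[k] A
  /-- the convolution inverse `β` of `x ↦ (x ▷ ·)` -/
  beta : A →ₗ[k] A →ₗ[k] A
  comul_tri : ∀ (x y : A) (sx : Sweedler k x) (sy : Sweedler k y),
    comul (R := k) (tri x y) = ∑ i ∈ sx.index, ∑ j ∈ sy.index,
      tri (sx.left i) (sy.left j) ⊗ₜ[k] tri (sx.right i) (sy.right j)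
  counit_tri : ∀ x y : A, counit (R := k) (tri x y) = counit (R := k) x * counit (R := k) y
  tri_mul : ∀ (x y z : A) (s : Sweedler k x),
    tri x (y * z) = ∑ i ∈ s.index, tri (s.left i) y * tri (s.right i) z
  tri_tri : ∀ (x y z : A) (s : Sweedler k x),
    tri x (tri y z) = tri (∑ i ∈ s.index, s.left i * tri (s.right i) y) z
  tri_beta : ∀ (x y : A) (s : Sweedler k x),
    ∑ i ∈ s.index, tri (s.left i) (beta (s.right i) y) = counit (R := k) x • y
  beta_tri : ∀ (x y : A) (s : Sweedler k x),
    ∑ i ∈ s.index, beta (s.left i) (tri (s.right i) y) = counit (R := k) x • y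

namespace PostHopfAlgebra

variable {k A : Type*} [CommRing k] [Ring A] [HopfAlgebra k A] (P : PostHopfAlgebra k A)

/-- The Grossman-Larson product `x * y = x₁ (x₂ ▷ y)`. -/
def glMul (x y : A) : A :=
  TensorProduct.lift ((LinearMap.mul k A).compl₂ (P.tri.flip y)) (comul (R := k) x)

/-- The antipode `S_▷(x) = β_{x₁}(S(x₂))` of the sub-adjacent Hopf algebra. -/
def subAntipode : A →ₗ[k] A :=
  TensorProduct.lift (P.beta.compl₂ (antipode k)) ∘ₗ comul

theorem glMul_eq (x y : A) (s : Sweedler k x) :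
    P.glMul x y = ∑ i ∈ s.index, s.left i * P.tri (s.right i) y := by
  simp [glMul, ← s.eq]

theorem subAntipode_eq (x : A) (s : Sweedler k x) :
    P.subAntipode x = ∑ i ∈ s.index, P.beta (s.left i) (antipode k (s.right i)) := by
  simp [subAntipode, ← s.eq]

/-- `R` is a module algebra, via `act`, over the bialgebra `(A, *, 1, Δ, ε)` where `*` is the
Grossman-Larson product. -/
structure IsModuleAlgebra {R : Type*} [CommRing R] [Algebra k R] (act : A →ₗ[k] R →ₗ[k] R) :
    Prop where
  glMul_act : ∀ x y f, act (P.glMul x y) f = act x (act y f)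
  one_act : ∀ f, act 1 f = f
  act_mul : ∀ (x : A) (f g : R) (s : Sweedler k x),
    act x (f * g) = ∑ i ∈ s.index, act (s.left i) f * act (s.right i) g
  act_one : ∀ x, act x 1 = algebraMap k R (counit (R := k) x)

end PostHopfAlgebra

/-! ### Post-Hopf algebroids -/

/-- A weak post-Hopf algebroid structure over `R` on a cocommutative Hopf `R`-algebra `H`, that is,
a cocommutative Hopf algebroid in which the image of `ι = algebraMap R H` is central. The fields on
the antipode restate that it is an algebra anti-isomorphism. -/
structure WeakPostHopfAlgebroid (k R H : Type*) [CommRing k] [CommRing R] [Algebra k R] [Ring H]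
    [Algebra k H] [HopfAlgebra R H] [IsScalarTower k R H] where
  cocomm : Coalgebra.IsCocomm R H
  antipode_mul : ∀ x y : H, antipode R (x * y) = antipode R y * antipode R x
  antipode_bijective : Function.Bijective (antipode R : H →ₗ[R] H)
  /-- the `k`-bilinear product `x ▷ y` -/
  tri : H →ₗ[k] H →ₗ[k] H
  comul_tri : ∀ (x y : H) (sx : Sweedler R x) (sy : Sweedler R y),
    comul (R := R) (tri x y) = ∑ i ∈ sx.index, ∑ j ∈ sy.index,
      tri (sx.left i) (sy.left j) ⊗ₜ[R] tri (sx.right i) (sy.right j)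
  tri_one : ∀ x, tri x 1 = algebraMap R H (counit (R := R) x)
  one_tri : ∀ x, tri 1 x = x
  counit_tri : ∀ x y, algebraMap R H (counit (R := R) (tri x y)) =
    tri x (algebraMap R H (counit (R := R) y))
  smul_tri : ∀ (f : R) (x y : H), tri (f • x) y = f • tri x y
  tri_mul : ∀ (x y z : H) (s : Sweedler R x),
    tri x (y * z) = ∑ i ∈ s.index, tri (s.left i) y * tri (s.right i) z
  tri_tri : ∀ (x y z : H) (s : Sweedler R x),
    tri x (tri y z) = tri (∑ i ∈ s.index, s.left i * tri (s.right i) y) z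

namespace WeakPostHopfAlgebroid

variable {k R H : Type*} [CommRing k] [CommRing R] [Algebra k R] [Ring H]
  [Algebra k H] [HopfAlgebra R H] [IsScalarTower k R H] (W : WeakPostHopfAlgebroid k R H)

/-- The Grossman-Larson product `x * y = x₁ (x₂ ▷ y)`, a `k`-bilinear map. -/
def glMul : H →ₗ[k] H →ₗ[k] H :=
  let m (y : H) : H ⊗[R] H →ₗ[R] H := TensorProduct.lift
    (LinearMap.mk₂ R (fun a b => a * W.tri b y) (fun _ _ _ => add_mul _ _ _)
      (fun _ _ _ => smul_mul_assoc _ _ _) (fun _ _ _ => by simp [mul_add])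
      (fun _ _ _ => by simp [W.smul_tri]))
  LinearMap.mk₂ k (fun x y => m y (comul (R := R) x))
    (fun _ _ _ => by simp)
    (fun c x y => by rw [← algebraMap_smul R c x, map_smul, map_smul, algebraMap_smul])
    (fun x y y' => by
      have : m (y + y') = m y + m y' := TensorProduct.ext' fun a b => by simp [m, mul_add]
      rw [this, LinearMap.add_apply])
    (fun c x y => by
      have : m (c • y) = algebraMap k R c • m y :=
        TensorProduct.ext' fun a b => by simp [m]
      rw [this, LinearMap.smul_apply, algebraMap_smul])

theorem glMul_eq (x y : H) (s : Sweedler R x) :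
    W.glMul x y = ∑ i ∈ s.index, s.left i * W.tri (s.right i) y := by
  simp [glMul, ← s.eq]

end WeakPostHopfAlgebroid

/-- A post-Hopf algebroid over `R`: a weak post-Hopf algebroid with an anti-automorphism `θ` of the
Grossman-Larson bialgebroid. The expressions `θ(x₁) ⊗ θ(x₂)` and `x₁ * θ(x₂)` are not balanced over
`R`; as in the definition of the antipode of a Hopf algebroid, they are formed after a `k`-linear
section `γ` of the projection `H ⊗_k H → H ⊗_R H`. -/
structure PostHopfAlgebroid (k R H : Type*) [CommRing k] [CommRing R] [Algebra k R] [Ring H]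
    [Algebra k H] [HopfAlgebra R H] [IsScalarTower k R H] extends
    WeakPostHopfAlgebroid k R H where
  /-- the anti-automorphism `θ` -/
  theta : H ≃ₗ[k] H
  theta_glMul : ∀ x y, theta (toWeakPostHopfAlgebroid.glMul x y) =
    toWeakPostHopfAlgebroid.glMul (theta y) (theta x)
  theta_algebraMap : ∀ f, theta (algebraMap R H f) = algebraMap R H f
  exists_section : ∃ γ : H ⊗[R] H →ₗ[k] H ⊗[k] H,
    (∀ t, TensorProduct.mapOfCompatibleSMul R k k H H (γ t) = t) ∧
    (∀ x, comul (R := R) (theta x) = TensorProduct.mapOfCompatibleSMul R k k H H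
      (TensorProduct.map theta.toLinearMap theta.toLinearMap (γ (comul (R := R) x)))) ∧
    ∀ x, TensorProduct.lift (toWeakPostHopfAlgebroid.glMul.compl₂ theta.toLinearMap)
      (γ (comul (R := R) x)) = algebraMap R H (counit (R := R) x)
  theta_glMul_self : ∀ (x : H) (s : Sweedler R x),
    ∑ i ∈ s.index, toWeakPostHopfAlgebroid.glMul (theta (s.left i)) (s.right i) =
      algebraMap R H (counit (R := R) (theta x))

/-- An isomorphism of post-Hopf algebroids over `R`. -/
structure PostHopfAlgebroid.Iso {k R H H' : Type*} [CommRing k] [CommRing R] [Algebra k R]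
    [Ring H] [Algebra k H] [HopfAlgebra R H] [IsScalarTower k R H]
    [Ring H'] [Algebra k H'] [HopfAlgebra R H'] [IsScalarTower k R H']
    (P : PostHopfAlgebroid k R H) (Q : PostHopfAlgebroid k R H') where
  /-- the underlying isomorphism of `R`-bialgebras -/
  equiv : H ≃ₐc[R] H'
  map_antipode : ∀ x, equiv (antipode R x) = antipode R (equiv x)
  map_tri : ∀ x y, equiv (P.tri x y) = Q.tri (equiv x) (equiv y)
  map_theta : ∀ x, equiv (P.theta x) = Q.theta (equiv x)

/-- The post-Hopf algebroid `H` on the tensor product Hopf `R`-algebra `R ⊗ A` is the action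
post-Hopf algebroid of the post-Hopf algebra `A` acting on `R` by `act`:
`fa ▷ gb = f (a₁ ⇀ g) (a₂ ▷ b)` and `θ(fa) = (S_▷(a₁) ⇀ f) S_▷(a₂)`. -/
structure PostHopfAlgebroid.IsAction {k R A : Type*} [CommRing k] [CommRing R] [Algebra k R]
    [Ring A] [HopfAlgebra k A] (H : PostHopfAlgebroid k R (R ⊗[k] A)) (P : PostHopfAlgebra k A)
    (act : A →ₗ[k] R →ₗ[k] R) : Prop where
  tri_tmul : ∀ (f g : R) (a b : A) (s : Sweedler k a), H.tri (f ⊗ₜ a) (g ⊗ₜ b) =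
    ∑ i ∈ s.index, (f * act (s.left i) g) ⊗ₜ[k] P.tri (s.right i) b
  theta_tmul : ∀ (f : R) (a : A) (s : Sweedler k a), H.theta (f ⊗ₜ a) =
    ∑ i ∈ s.index, act (P.subAntipode (s.left i)) f ⊗ₜ[k] P.subAntipode (s.right i)

/-! ### The products on universal enveloping algebras -/

/-- The recursion that defines the product `▷` of `U_R(L)` for a post-Lie-Rinehart algebra
`(R, L, [-,-], ρ, ▷)`. -/
structure PostLieRinehart.IsEnvelopingProduct {k R L : Type*} [CommRing k] [CommRing R]
    [Algebra k R] [LieRing L] [LieAlgebra R L] [Module k L] [IsScalarTower k R L]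
    (Q : PostLieRinehart k R L)
    (tri : UniversalEnvelopingAlgebra R L → UniversalEnvelopingAlgebra R L →
      UniversalEnvelopingAlgebra R L) : Prop where
  base_tri : ∀ (f : R) X, tri (algebraMap R _ f) X = algebraMap R _ f * X
  tri_base : ∀ (x : L) (f : R), tri (ι R x) (algebraMap R _ f) = algebraMap R _ (Q.anchor x f)
  tri_ι : ∀ x y : L, tri (ι R x) (ι R y) = ι R (Q.tri x y)
  tri_mul : ∀ (x y : L) X,
    tri (ι R x) (ι R y * X) = ι R (Q.tri x y) * X + ι R y * tri (ι R x) X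
  mul_tri : ∀ (x : L) X Y, tri (ι R x * X) Y = tri (ι R x) (tri X Y) - tri (tri (ι R x) X) Y

section Enveloping

variable {k R g : Type*} [CommRing k] [CommRing R] [Algebra k R] [LieRing g] [LieAlgebra k g]
  (P : PostLieAlgebra k g)

/-- The Oudom-Guin isomorphism `Φ : U(g_▷) → U(g)_▷`, the isomorphism of Hopf algebras onto the
sub-adjacent Hopf algebra of `U(g)` that extends the identity of `g`. -/
structure OudomGuinIso (A : PostHopfAlgebra k (UniversalEnvelopingAlgebra k g)) where
  /-- the underlying isomorphism of coalgebras -/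
  equiv : UniversalEnvelopingAlgebra k P.SubAdjacent ≃ₗc[k] UniversalEnvelopingAlgebra k g
  map_one : equiv 1 = 1
  map_mul : ∀ X Y, equiv (X * Y) = A.glMul (equiv X) (equiv Y)
  map_ι : ∀ x, equiv (ι k x) = ι k (P.ofSub x)

/-- The lift of `ρ : g_▷ → Der(R)` to an action of `U(g_▷)` on `R`. -/
def liftDer (ρ : P.SubAdjacent →ₗ⁅k⁆ Derivation k R R) :
    UniversalEnvelopingAlgebra k P.SubAdjacent →ₐ[k] Module.End k R :=
  UniversalEnvelopingAlgebra.lift k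
    { toFun := fun x => (ρ x : R →ₗ[k] R)
      map_add' := fun x y => by rw [map_add]; rfl
      map_smul' := fun c x => by rw [map_smul]; rfl
      map_lie' := fun {x y} => by rw [LieHom.map_lie, Derivation.commutator_coe_linear_map] }

/-- The action of `U(g)_▷` on `R`, pulled back along `Φ⁻¹`. -/
def OudomGuinIso.act {P : PostLieAlgebra k g}
    {A : PostHopfAlgebra k (UniversalEnvelopingAlgebra k g)}
    (Φ : OudomGuinIso P A) (ρ : P.SubAdjacent →ₗ⁅k⁆ Derivation k R R) :
    UniversalEnvelopingAlgebra k g →ₗ[k] R →ₗ[k] R :=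
  (liftDer P ρ).toLinearMap ∘ₗ Φ.equiv.toLinearEquiv.symm.toLinearMap

end Enveloping

end

noncomputable section

open Coalgebra (comul counit)
open HopfAlgebra (antipode)

/-! ### Further properties of universal enveloping algebras -/

namespace UniversalEnvelopingAlgebra

variable {k l : Type*} [CommRing k] [LieRing l] [LieAlgebra k l]

/-! Everything is read off from representations of the sub-adjacent Lie algebra `g_▷`. Each `x ▷ ·`
extends to a derivation `D_x` of `U(g)`, and the two post-Lie axioms say that `x ↦ D_x` and `x ↦ x ·
+ D_x` are both actions of `g_▷` on `U(g)`. They extend to `act` and `mulAct` on `U(g_▷)`. The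
Oudom-Guin map is the orbit map `Φ(u) = mulAct u 1`. The post-Hopf product is `Φ(u) ▷ a = act u a`,
the Grossman-Larson product is `Φ(u) * a = mulAct u a`, and `β` is `act` after the antipode of
`U(g_▷)`. The axioms then become multiplicativity of `act` and Leibniz rules, all of which are
instances of `map_bilin_eq_sum`: if the generators act on a bilinear map by the Leibniz rule, then
all of the enveloping algebra acts through its coproduct.

That `Φ` is bijective is shown without a Poincaré-Birkhoff-Witt theorem. The derivations `D_x` are
carried back to operators `coder x` on `U(g_▷)`, which exist by a triangular representation
(`exists_twistedDerivation`). Then `x ↦ x · - coder x` is an action of `g` on `U(g_▷)`, and its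
orbit map of `1` is inverse to `Φ`.

On `H = R ⊗ U(g)` the same two actions are tensored with `ρ`, giving `actH` and `mulActH`. Both are
compatible with the module structure over `R` (`IsTwisted`), and any such action `N` extends
`R`-linearly by `hat N (f ⊗ Φ(u)) = f N(u)`. The key fact is `hat_hat`: for the product `* = hat
mulActH`, each `hat N` is a representation. Taking `N = mulActH` gives associativity of `*`, and `N
= actH` gives the last axiom of a weak post-Hopf algebroid. The anti-automorphism is `θ(f ⊗ Φ(u)) =
S(u) * f`, an involution because `S² = 1` on `U(g_▷)`.

Finally `U_R(R ⊗ g)` and `R ⊗ U(g)` are isomorphic `R`-bialgebras, so the structure is transported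
and the isomorphism asked for is the one used for the transport. The recursion for the transported
product follows from its values on generators, since these are primitive. Uniqueness is an induction
on word length. -/

theorem comul_ι_mul (x : l) (a : UniversalEnvelopingAlgebra k l) :
    comul (R := k) (ι k x * a) =
      (ι k x ⊗ₜ[k] 1 + 1 ⊗ₜ[k] ι k x) * comul (R := k) a := by
  rw [comul_eq, map_mul, comulHom_ι, comul_eq]

theorem comul_algebraMap (r : k) :
    comul (R := k) (algebraMap k (UniversalEnvelopingAlgebra k l) r) =
      algebraMap k (UniversalEnvelopingAlgebra k l) r ⊗ₜ[k] 1 := by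
  rw [comul_eq, AlgHom.commutes, Algebra.TensorProduct.algebraMap_apply]

theorem comul_ι (x : l) : comul (R := k) (ι k x) = ι k x ⊗ₜ[k] 1 + 1 ⊗ₜ[k] ι k x :=
  comulHom_ι k x

theorem counit_ι_mul (x : l) (a : UniversalEnvelopingAlgebra k l) :
    counit (R := k) (ι k x * a) = 0 := by
  rw [counit_eq, map_mul, counitHom_ι, zero_mul]

theorem counit_algebraMap (r : k) :
    counit (R := k) (algebraMap k (UniversalEnvelopingAlgebra k l) r) = r :=
  AlgHom.commutes _ r

theorem antipode_ι_mul (x : l) (a : UniversalEnvelopingAlgebra k l) :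
    antipode k (ι k x * a) = -(antipode k a * ι k x) := by
  show antipodeLin k _ = -(antipodeLin k _ * _)
  rw [antipodeLin_mul, antipodeLin_ι, mul_neg]

theorem antipode_algebraMap (r : k) :
    antipode k (algebraMap k (UniversalEnvelopingAlgebra k l) r) = algebraMap k _ r :=
  antipodeLin_algebraMap k r

theorem antipode_mul (a b : UniversalEnvelopingAlgebra k l) :
    antipode k (a * b) = antipode k b * antipode k a :=
  antipodeLin_mul k a b

theorem antipode_ι (x : l) : antipode k (ι k x) = -ι k x := antipodeLin_ι k x

theorem antipode_antipode (a : UniversalEnvelopingAlgebra k l) :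
    antipode k (antipode k a) = a := by
  induction a using word_induction with
  | scalar r => rw [antipode_algebraMap, antipode_algebraMap]
  | add a b ha hb => rw [map_add, map_add, ha, hb]
  | mul x a ha => rw [antipode_ι_mul, map_neg, antipode_mul, antipode_ι, ha, neg_mul, neg_neg]

instance : Coalgebra.IsCocomm k (UniversalEnvelopingAlgebra k l) where
  comm_comp_comul := by
    have : ((Algebra.TensorProduct.comm k _ _).toAlgHom.comp (comulHom k) :
        UniversalEnvelopingAlgebra k l →ₐ[k] _) = comulHom k :=
      algHom_ext' fun x => by simp [-ι_apply, add_comm]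
    exact congrArg AlgHom.toLinearMap this

/-- The antipode is a coalgebra homomorphism. -/
theorem comul_antipode (a : UniversalEnvelopingAlgebra k l) :
    comul (R := k) (antipode k a) =
      TensorProduct.map (antipode k) (antipode k) (comul (R := k) a) := by
  -- An antipode reverses the tensor factors of a coproduct in general. Here the reversal is
  -- invisible, because `x ⊗ 1 + 1 ⊗ x` is symmetric.
  have key : ∀ (x : l) (z : UniversalEnvelopingAlgebra k l ⊗[k] UniversalEnvelopingAlgebra k l),
      TensorProduct.map (antipode k) (antipode k) ((ι k x ⊗ₜ[k] 1 + 1 ⊗ₜ[k] ι k x) * z) =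
        -(TensorProduct.map (antipode k) (antipode k) z *
          (ι k x ⊗ₜ[k] 1 + 1 ⊗ₜ[k] ι k x)) := by
    intro x z
    induction z with
    | zero => simp
    | add a b ha hb => rw [mul_add, map_add, ha, hb, map_add, add_mul, neg_add]
    | tmul a b =>
      simp only [add_mul, Algebra.TensorProduct.tmul_mul_tmul, one_mul, map_add,
        TensorProduct.map_tmul, antipode_ι_mul, mul_add, mul_one, TensorProduct.neg_tmul,
        TensorProduct.tmul_neg, neg_add]
  induction a using word_induction with
  | scalar r =>
    rw [antipode_algebraMap, comul_algebraMap, TensorProduct.map_tmul, antipode_algebraMap,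
      HopfAlgebra.antipode_one]
  | add a b ha hb => simp only [map_add, ha, hb]
  | mul x a ha =>
    rw [comul_ι_mul, key, ← ha, antipode_ι_mul, map_neg, comul_eq, map_mul, comulHom_ι, comul_eq]

theorem lift_ι_mul {B : Type*} [Ring B] [Algebra k B] (f : l →ₗ⁅k⁆ B) (x : l)
    (a : UniversalEnvelopingAlgebra k l) : lift k f (ι k x * a) = f x * lift k f a := by
  rw [map_mul, lift_ι_apply]

section Leibniz

variable {V₁ V₂ V₃ : Type*} [AddCommGroup V₁] [Module k V₁] [AddCommGroup V₂] [Module k V₂]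
  [AddCommGroup V₃] [Module k V₃]

/-- If a Lie algebra acts compatibly with a bilinear map, then its universal enveloping algebra
acts compatibly through the coproduct. -/
theorem map_bilin_eq_sum {a₁ : UniversalEnvelopingAlgebra k l →ₐ[k] Module.End k V₁}
    {a₂ : UniversalEnvelopingAlgebra k l →ₐ[k] Module.End k V₂}
    {a₃ : UniversalEnvelopingAlgebra k l →ₐ[k] Module.End k V₃}
    (m : V₁ →ₗ[k] V₂ →ₗ[k] V₃)
    (h : ∀ x v w, a₃ (ι k x) (m v w) = m (a₁ (ι k x) v) w + m v (a₂ (ι k x) w))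
    {I : Type*} {u : UniversalEnvelopingAlgebra k l} (s : Coalgebra.Repr k u I) (v : V₁) (w : V₂) :
    a₃ u (m v w) = ∑ i ∈ s.index, m (a₁ (s.left i) v) (a₂ (s.right i) w) := by
  -- The right-hand side is `B (Δ u)`. The hypothesis `h` says that `B` turns multiplication by
  -- `Δ(x)` into the operator `a₃ x`, which is what the induction on words needs.
  let B : UniversalEnvelopingAlgebra k l ⊗[k] UniversalEnvelopingAlgebra k l →ₗ[k] V₃ :=
    TensorProduct.lift ((m ∘ₗ a₁.toLinearMap.flip v).compl₂ (a₂.toLinearMap.flip w))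
  have hB : ∀ p q, B (p ⊗ₜ q) = m (a₁ p v) (a₂ q w) := fun p q => rfl
  have key : ∀ (x : l) z, B ((ι k x ⊗ₜ[k] 1 + 1 ⊗ₜ[k] ι k x) * z) = a₃ (ι k x) (B z) := by
    intro x z
    induction z with
    | zero => simp
    | add a b ha hb => rw [mul_add, map_add, ha, hb, map_add, map_add]
    | tmul a b =>
      simp only [add_mul, Algebra.TensorProduct.tmul_mul_tmul, one_mul, map_add, hB, map_mul,
        Module.End.mul_apply, h]
  have main : ∀ u, a₃ u (m v w) = B (comul (R := k) u) := by
    intro u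
    induction u using word_induction with
    | scalar r => simp [hB, Module.algebraMap_end_apply]
    | add a b ha hb => simp only [map_add, LinearMap.add_apply, ha, hb]
    | mul x a ha => rw [comul_ι_mul, key, ← ha, map_mul, Module.End.mul_apply]
  rw [main, ← s.eq, map_sum]
  rfl

end Leibniz

/-- The Lie algebra action on `B × Hom(M, B)` whose off-diagonal part is `b ↦ (x ↦ t(x, y) b)`. -/
def twistedAction {B M : Type*} [Ring B] [Algebra k B] [AddCommGroup M] [Module k M]
    (j : l →ₗ⁅k⁆ B) (t : M →ₗ[k] l →ₗ[k] l) (s : l →ₗ[k] M →ₗ[k] M)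
    (hs : ∀ y z x, s ⁅y, z⁆ x = s z (s y x) - s y (s z x))
    (ht : ∀ x y z, t x ⁅y, z⁆ = ⁅t x y, z⁆ + ⁅y, t x z⁆ + t (s y x) z - t (s z x) y) :
    l →ₗ⁅k⁆ Module.End k (B × (M →ₗ[k] B)) where
  toFun y :=
    { toFun := fun p => (j y * p.1,
        ((LinearMap.mul k B).flip p.1) ∘ₗ (j : l →ₗ[k] B) ∘ₗ t.flip y +
          LinearMap.mulLeft k (j y) ∘ₗ p.2 + p.2 ∘ₗ s y)
      map_add' := fun p q => by
        refine Prod.ext ?_ (LinearMap.ext fun x => ?_)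
        · simp [mul_add]
        · simp [mul_add]; abel
      map_smul' := fun c p => by
        refine Prod.ext ?_ (LinearMap.ext fun x => ?_)
        · simp
        · simp }
  map_add' y z := by
    refine LinearMap.ext fun p => Prod.ext ?_ (LinearMap.ext fun x => ?_)
    · simp [add_mul]
    · simp [add_mul]; abel
  map_smul' c y := by
    refine LinearMap.ext fun p => Prod.ext ?_ (LinearMap.ext fun x => ?_)
    · simp
    · simp
  map_lie' {y z} := by
    refine LinearMap.ext fun p => Prod.ext ?_ (LinearMap.ext fun x => ?_)
    · simp [LieRing.of_associative_ring_bracket, sub_mul, mul_assoc]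
    · simp [LieRing.of_associative_ring_bracket, ht, hs, mul_add, sub_mul, mul_assoc]
      abel

/-- A twisted derivation of `U(l)` with parameters in a module `M`. For `s = 0` it is the
derivation of `U(l)` that extends a derivation of `l`. -/
theorem exists_twistedDerivation {M : Type*} [AddCommGroup M] [Module k M]
    (t : M →ₗ[k] l →ₗ[k] l) (s : l →ₗ[k] M →ₗ[k] M)
    (hs : ∀ y z x, s ⁅y, z⁆ x = s z (s y x) - s y (s z x))
    (ht : ∀ x y z, t x ⁅y, z⁆ = ⁅t x y, z⁆ + ⁅y, t x z⁆ + t (s y x) z - t (s z x) y) :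
    ∃ E : M →ₗ[k] Module.End k (UniversalEnvelopingAlgebra k l),
      (∀ x r, E x (algebraMap k _ r) = 0) ∧
      ∀ x y u, E x (ι k y * u) = ι k (t x y) * u + ι k y * E x u + E (s y x) u := by
  -- The recursion defines an operator only if it respects the relations of `U(l)`; `hs` and `ht`
  -- say that it does. The action is triangular on `U(l) × Hom(M, U(l))`, and in the orbit of `(1,
  -- 0)` the first component is `u` itself while the second is the map `x ↦ E x u`.
  let A := twistedAction (ι k : l →ₗ⁅k⁆ UniversalEnvelopingAlgebra k l) t s hs ht
  let F := lift k A
  have hF : ∀ y u p, F (ι k y * u) p = A y (F u p) := fun y u p => by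
    rw [lift_ι_mul, Module.End.mul_apply]
  have hr : ∀ r p, F (algebraMap k _ r) p = r • p := fun r p => by
    rw [AlgHom.commutes, Module.algebraMap_end_apply]
  have h1 : ∀ u, (F u (1, 0)).1 = u := by
    intro u
    induction u using word_induction with
    | scalar r => rw [hr, Algebra.algebraMap_eq_smul_one]; rfl
    | add a b ha hb => simp only [map_add, LinearMap.add_apply, Prod.fst_add, ha, hb]
    | mul x a ha =>
      rw [hF]
      show ι k x * (F a (1, 0)).1 = _
      rw [ha]
  refine ⟨(LinearMap.snd k _ _ ∘ₗ (F.toLinearMap.flip (1, 0))).flip, fun x r => ?_,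
    fun x y u => ?_⟩
  · show (F (algebraMap k _ r) (1, 0)).2 x = 0
    rw [hr, Prod.smul_snd, smul_zero, LinearMap.zero_apply]
  · show (F (ι k y * u) (1, 0)).2 x = _
    rw [hF]
    show ι k (t x y) * (F u (1, 0)).1 + ι k y * (F u (1, 0)).2 x + (F u (1, 0)).2 (s y x) = _
    rw [h1]
    rfl

end UniversalEnvelopingAlgebra

open UniversalEnvelopingAlgebra (word_induction)

/-! ### The Oudom-Guin isomorphism -/

namespace PostLieAlgebra

variable {k g : Type*} [CommRing k] [LieRing g] [LieAlgebra k g] (P : PostLieAlgebra k g)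

local notation "U" => UniversalEnvelopingAlgebra k g
local notation "Us" => UniversalEnvelopingAlgebra k P.SubAdjacent

theorem exists_der : ∃ D : P.SubAdjacent →ₗ[k] Module.End k U,
    (∀ x r, D x (algebraMap k _ r) = 0) ∧
    ∀ x y u, D x (ι k y * u) = ι k (P.tri (P.ofSub x) y) * u + ι k y * D x u := by
  obtain ⟨D, h1, h2⟩ := UniversalEnvelopingAlgebra.exists_twistedDerivation
    (P.tri ∘ₗ P.ofSub.toLinearMap) 0 (by simp) (fun x y z => by simp [P.tri_lie])
  exact ⟨D, h1, fun x y u => by simpa using h2 x y u⟩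

/-- The derivations of `U(g)` that extend `x ▷ ·`, as a linear map. -/
def derLin : P.SubAdjacent →ₗ[k] Module.End k U := P.exists_der.choose

@[simp] theorem derLin_algebraMap (x r) : P.derLin x (algebraMap k _ r) = 0 :=
  P.exists_der.choose_spec.1 x r

theorem derLin_ι_mul (x y u) :
    P.derLin x (ι k y * u) = ι k (P.tri (P.ofSub x) y) * u + ι k y * P.derLin x u :=
  P.exists_der.choose_spec.2 x y u

@[simp] theorem derLin_one (x) : P.derLin x 1 = 0 := by
  rw [← map_one (algebraMap k U), derLin_algebraMap]

theorem derLin_ι (x y) : P.derLin x (ι k y) = ι k (P.tri (P.ofSub x) y) := by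
  have := P.derLin_ι_mul x y 1
  simpa only [mul_one, derLin_one, mul_zero, add_zero] using this

theorem derLin_mul (x a b) : P.derLin x (a * b) = P.derLin x a * b + a * P.derLin x b := by
  induction a using word_induction with
  | scalar r =>
    rw [derLin_algebraMap, zero_mul, zero_add, ← Algebra.smul_def, map_smul, Algebra.smul_def]
  | add a c ha hc => simp only [add_mul, map_add, ha, hc]; abel
  | mul y a ha => rw [mul_assoc, derLin_ι_mul, derLin_ι_mul, ha]; noncomm_ring

/-- The second post-Lie axiom in the form used throughout: `▷` is an action of the sub-adjacent Lie
algebra on `g`. -/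
theorem tri_ofSub_lie (x y : P.SubAdjacent) (z : g) : P.tri (P.ofSub ⁅x, y⁆) z =
    P.tri (P.ofSub x) (P.tri (P.ofSub y) z) - P.tri (P.ofSub y) (P.tri (P.ofSub x) z) := by
  rw [← P.lie_tri, ofSub_lie]
  congr 2
  abel

/-- The action of `g_▷` on `U(g)` by the derivations that extend `x ▷ ·`. -/
def der : P.SubAdjacent →ₗ⁅k⁆ Module.End k U where
  toFun := P.derLin
  map_add' := map_add P.derLin
  map_smul' := map_smul P.derLin
  map_lie' {x y} := by
    ext u
    show P.derLin ⁅x, y⁆ u = P.derLin x (P.derLin y u) - P.derLin y (P.derLin x u)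
    induction u using word_induction with
    | scalar r => simp
    | add a b ha hb => simp only [map_add, ha, hb]; abel
    | mul z u hu =>
      simp only [derLin_ι_mul, hu, tri_ofSub_lie, map_add, map_sub]
      noncomm_ring

/-- The action of `g_▷` on `U(g)` by `x ↦ x · + x ▷ ·`. -/
def mulDer : P.SubAdjacent →ₗ⁅k⁆ Module.End k U where
  toFun x := LinearMap.mulLeft k (ι k (P.ofSub x)) + P.derLin x
  map_add' x y := by ext u; simp [add_mul]; abel
  map_smul' c x := by ext u; simp
  -- The commutator of `x · + D_x` and `y · + D_y` is multiplication by `[x, y] + x ▷ y - y ▷ x`,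
  -- plus the commutator of `D_x` and `D_y`. The first element is the sub-adjacent bracket, the
  -- second operator is its derivation.
  map_lie' {x y} := by
    ext u
    have h : P.derLin ⁅x, y⁆ u = P.derLin x (P.derLin y u) - P.derLin y (P.derLin x u) :=
      LinearMap.congr_fun (P.der.map_lie x y) u
    show ι k (P.ofSub ⁅x, y⁆) * u + P.derLin ⁅x, y⁆ u =
      (ι k (P.ofSub x) * (ι k (P.ofSub y) * u + P.derLin y u) +
        P.derLin x (ι k (P.ofSub y) * u + P.derLin y u)) -
      (ι k (P.ofSub y) * (ι k (P.ofSub x) * u + P.derLin x u) +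
        P.derLin y (ι k (P.ofSub x) * u + P.derLin x u))
    simp only [h, map_add, derLin_ι_mul, ofSub_lie, map_sub, LieHom.map_lie,
      LieRing.of_associative_ring_bracket]
    noncomm_ring

/-- The action of `U(g_▷)` on `U(g)` that extends `x ▷ ·`. -/
def act : Us →ₐ[k] Module.End k U := UniversalEnvelopingAlgebra.lift k P.der

/-- The action of `U(g_▷)` on `U(g)` that extends `x · + x ▷ ·`. -/
def mulAct : Us →ₐ[k] Module.End k U := UniversalEnvelopingAlgebra.lift k P.mulDer

theorem act_ι (x a) : P.act (ι k x) a = P.derLin x a := by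
  rw [act, UniversalEnvelopingAlgebra.lift_ι_apply]; rfl

theorem mulAct_ι (x a) : P.mulAct (ι k x) a = ι k (P.ofSub x) * a + P.derLin x a := by
  rw [mulAct, UniversalEnvelopingAlgebra.lift_ι_apply]; rfl

/-- The Oudom-Guin map `U(g_▷) → U(g)`. -/
def oudomGuin : Us →ₗ[k] U := P.mulAct.toLinearMap.flip 1

theorem oudomGuin_apply (u) : P.oudomGuin u = P.mulAct u 1 := rfl

@[simp] theorem oudomGuin_algebraMap (r) :
    P.oudomGuin (algebraMap k _ r) = algebraMap k _ r := by
  rw [oudomGuin_apply, AlgHom.commutes, Module.algebraMap_end_apply,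
    Algebra.algebraMap_eq_smul_one]

theorem oudomGuin_one : P.oudomGuin 1 = 1 := by
  rw [← map_one (algebraMap k Us), oudomGuin_algebraMap, map_one]

/-- An orbit map is equivariant; this becomes multiplicativity of `Φ` once `mulAct` is recognised as
the Grossman-Larson product. -/
theorem oudomGuin_mul (u v) : P.oudomGuin (u * v) = P.mulAct u (P.oudomGuin v) := by
  rw [oudomGuin_apply, map_mul]; rfl

theorem oudomGuin_ι_mul (x v) : P.oudomGuin (ι k x * v) =
    ι k (P.ofSub x) * P.oudomGuin v + P.derLin x (P.oudomGuin v) := by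
  rw [oudomGuin_mul, mulAct_ι]

theorem oudomGuin_ι (x) : P.oudomGuin (ι k x) = ι k (P.ofSub x) := by
  rw [oudomGuin_apply, mulAct_ι, mul_one, derLin_one, add_zero]

/-- The product `▷` on the sub-adjacent Lie algebra. -/
def subTri : P.SubAdjacent →ₗ[k] P.SubAdjacent →ₗ[k] P.SubAdjacent :=
  (P.tri.compl₁₂ P.ofSub.toLinearMap P.ofSub.toLinearMap).compr₂ P.ofSub.symm.toLinearMap

theorem ofSub_subTri (x y) : P.ofSub (P.subTri x y) = P.tri (P.ofSub x) (P.ofSub y) := rfl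

theorem subTri_lie_left (x y z : P.SubAdjacent) : P.subTri ⁅x, y⁆ z =
    P.subTri x (P.subTri y z) - P.subTri y (P.subTri x z) := by
  apply P.ofSub.injective
  simp only [map_sub, ofSub_subTri, tri_ofSub_lie]

/-- The map `(y, x) ↦ [x, y] - x ▷ y` for the bracket of the sub-adjacent Lie algebra. -/
def subAd : P.SubAdjacent →ₗ[k] P.SubAdjacent →ₗ[k] P.SubAdjacent :=
  LinearMap.mk₂ k (fun y x => ⁅x, y⁆ - P.subTri x y)
    (fun a b c => by simp only [map_add, lie_add]; abel)
    (fun r a b => by simp only [map_smul, lie_smul, smul_sub])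
    (fun a b c => by simp only [map_add, LinearMap.add_apply, add_lie]; abel)
    (fun r a b => by simp only [map_smul, LinearMap.smul_apply, smul_lie, smul_sub])

theorem subAd_apply (x y) : P.subAd y x = ⁅x, y⁆ - P.subTri x y := rfl

/-- `x ▷ ·` is a derivation of the bracket of `g` but not of the sub-adjacent one. The defect
consists of the two `subAd` terms, which is the shape that the hypothesis `ht` of a twisted
derivation allows. -/
theorem subTri_lie (x y z : P.SubAdjacent) : P.subTri x ⁅y, z⁆ =
    ⁅P.subTri x y, z⁆ + ⁅y, P.subTri x z⁆ + P.subTri (P.subAd y x) z -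
      P.subTri (P.subAd z x) y := by
  rw [subAd_apply, subAd_apply, map_sub, map_sub, LinearMap.sub_apply, LinearMap.sub_apply,
    subTri_lie_left, subTri_lie_left]
  apply P.ofSub.injective
  simp only [map_sub, map_add, ofSub_subTri, ofSub_lie, P.tri_lie]
  abel

/-- In terms of `g`, `-subAd y` is the operator `x ↦ y ▷ x + [y, x]`, an action of `g_▷`. The sign
makes `subAd` a right action, as twisted derivations require. -/
theorem subAd_lie (y z x : P.SubAdjacent) :
    P.subAd ⁅y, z⁆ x = P.subAd z (P.subAd y x) - P.subAd y (P.subAd z x) := by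
  have h1 := P.subTri_lie x y z
  have h2 := P.subTri_lie_left x y z
  have h3 := P.subTri_lie_left x z y
  simp only [subAd_apply, map_sub, LinearMap.sub_apply] at h1 ⊢
  have e1 : ⁅y, P.subTri x z⁆ = -⁅P.subTri x z, y⁆ := (lie_skew _ _).symm
  have e2 : ⁅x, ⁅y, z⁆⁆ = ⁅⁅x, y⁆, z⁆ - ⁅⁅x, z⁆, y⁆ := by
    rw [leibniz_lie x y z, ← lie_skew y ⁅x, z⁆]; abel
  rw [h1, e1, e2]
  abel

/-- The recursion is forced by the wish that `Φ (D x u) = x ▷ Φ u`. Expanding `x ▷ Φ(yu)` with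
`Φ(yu) = y Φ(u) + y ▷ Φ(u)`, the commutator of `x ▷` and `y ▷` contributes `[x, y] ▷ Φ(u)`, and
`Φ((x ▷ y) u)` takes away `(x ▷ y) ▷ Φ(u)`. What remains is the `subAd` term. -/
theorem exists_coder : ∃ D : P.SubAdjacent →ₗ[k] Module.End k Us,
    (∀ x r, D x (algebraMap k _ r) = 0) ∧
    ∀ x y u, D x (ι k y * u) =
      ι k (P.subTri x y) * u + ι k y * D x u + D (P.subAd y x) u :=
  UniversalEnvelopingAlgebra.exists_twistedDerivation P.subTri P.subAd P.subAd_lie P.subTri_lie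

/-- The coderivations of `U(g_▷)` that correspond to the derivations `x ▷ ·` of `U(g)`. -/
def coder : P.SubAdjacent →ₗ[k] Module.End k Us := P.exists_coder.choose

@[simp] theorem coder_algebraMap (x r) : P.coder x (algebraMap k _ r) = 0 :=
  P.exists_coder.choose_spec.1 x r

theorem coder_ι_mul (x y u) : P.coder x (ι k y * u) =
    ι k (P.subTri x y) * u + ι k y * P.coder x u + P.coder (P.subAd y x) u :=
  P.exists_coder.choose_spec.2 x y u

theorem coder_lie (x y u) :
    P.coder ⁅x, y⁆ u = P.coder x (P.coder y u) - P.coder y (P.coder x u) := by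
  -- The twist term of the recursion applies `coder` to `u` with a changed parameter, so the
  -- induction hypothesis is needed for all `x` and `y`.
  induction u using word_induction generalizing x y with
  | scalar r => simp
  | add a b ha hb => simp only [map_add, ha, hb]; abel
  | mul z u hu =>
    have h : P.subAd z ⁅x, y⁆ = P.subAd (P.subTri y z) x - P.subAd (P.subTri x z) y +
        ⁅P.subAd z x, y⁆ + ⁅x, P.subAd z y⁆ := by
      have e1 : ⁅y, P.subTri x z⁆ = -⁅P.subTri x z, y⁆ := (lie_skew _ _).symm
      have e2 : ⁅x, ⁅y, z⁆⁆ = ⁅⁅x, y⁆, z⁆ - ⁅⁅x, z⁆, y⁆ := by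
        rw [leibniz_lie x y z, ← lie_skew y ⁅x, z⁆]; abel
      simp only [subAd_apply, subTri_lie_left, sub_lie, lie_sub, e1, e2]
      abel
    simp only [coder_ι_mul, h, hu, map_add, map_sub, LinearMap.add_apply, LinearMap.sub_apply,
      subTri_lie_left, sub_mul, mul_sub]
    abel

/-- The action `x ↦ x · - x ▷ ·` of `g` on `U(g_▷)`. -/
def coMul : g →ₗ⁅k⁆ Module.End k Us where
  toFun x := LinearMap.mulLeft k (ι k (P.ofSub.symm x)) - P.coder (P.ofSub.symm x)
  map_add' x y := by ext u; simp [add_mul]; abel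
  map_smul' c x := by ext u; simp [smul_sub]
  map_lie' {x y} := by
    ext u
    obtain ⟨x, rfl⟩ := P.ofSub.surjective x
    obtain ⟨y, rfl⟩ := P.ofSub.surjective y
    have h : P.ofSub.symm ⁅P.ofSub x, P.ofSub y⁆ = ⁅x, y⁆ - P.subTri x y + P.subTri y x := by
      apply P.ofSub.injective
      simp only [map_add, map_sub, ofSub_subTri, ofSub_lie, LinearEquiv.apply_symm_apply]
      abel
    have h' : P.coder ⁅y, x⁆ u = - P.coder ⁅x, y⁆ u := by
      rw [← lie_skew, map_neg, LinearMap.neg_apply]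
    simp only [LinearEquiv.symm_apply_apply]
    show ι k (P.ofSub.symm ⁅P.ofSub x, P.ofSub y⁆) * u -
        P.coder (P.ofSub.symm ⁅P.ofSub x, P.ofSub y⁆) u =
      (ι k x * (ι k y * u - P.coder y u) - P.coder x (ι k y * u - P.coder y u)) -
      (ι k y * (ι k x * u - P.coder x u) - P.coder y (ι k x * u - P.coder x u))
    simp only [h, coder_ι_mul, map_add, map_sub, subAd_apply, LinearMap.add_apply,
      LinearMap.sub_apply, LieHom.map_lie, LieRing.of_associative_ring_bracket, h', coder_lie,
      sub_mul, mul_sub, add_mul, mul_assoc]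
    abel

/-- The inverse `U(g) → U(g_▷)` of the Oudom-Guin map. -/
def oudomGuinInv : U →ₗ[k] Us :=
  (UniversalEnvelopingAlgebra.lift k P.coMul).toLinearMap.flip 1

theorem oudomGuinInv_algebraMap (r) :
    P.oudomGuinInv (algebraMap k _ r) = algebraMap k _ r := by
  show UniversalEnvelopingAlgebra.lift k P.coMul _ 1 = _
  rw [AlgHom.commutes, Module.algebraMap_end_apply, Algebra.algebraMap_eq_smul_one]

theorem oudomGuinInv_ι_mul (x a) : P.oudomGuinInv (ι k (P.ofSub x) * a) =
    ι k x * P.oudomGuinInv a - P.coder x (P.oudomGuinInv a) := by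
  show UniversalEnvelopingAlgebra.lift k P.coMul _ 1 = _
  rw [UniversalEnvelopingAlgebra.lift_ι_mul]
  rfl

theorem oudomGuin_coder (x u) : P.oudomGuin (P.coder x u) = P.derLin x (P.oudomGuin u) := by
  induction u using word_induction generalizing x with
  | scalar r => simp
  | add a b ha hb => simp only [map_add, ha, hb]
  | mul y u hu =>
    have h : P.derLin ⁅x, y⁆ (P.oudomGuin u) = P.derLin x (P.derLin y (P.oudomGuin u)) -
        P.derLin y (P.derLin x (P.oudomGuin u)) := LinearMap.congr_fun (P.der.map_lie x y) _
    simp only [coder_ι_mul, map_add, oudomGuin_ι_mul, hu, subAd_apply, map_sub,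
      LinearMap.sub_apply, h, derLin_ι_mul, ofSub_subTri]
    abel

/-- Together with `oudomGuin_coder` this lets the correction terms `+ x ▷` of `Φ` and `- x ▷` of its
inverse cancel in both composites. -/
theorem oudomGuinInv_derLin (x a) :
    P.oudomGuinInv (P.derLin x a) = P.coder x (P.oudomGuinInv a) := by
  induction a using word_induction generalizing x with
  | scalar r => simp [oudomGuinInv_algebraMap]
  | add a b ha hb => simp only [map_add, ha, hb]
  | mul y a ha =>
    obtain ⟨y, rfl⟩ := P.ofSub.surjective y
    simp only [derLin_ι_mul, map_add, ← ofSub_subTri, oudomGuinInv_ι_mul, ha, map_sub,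
      coder_ι_mul, subAd_apply, LinearMap.sub_apply, coder_lie]
    abel

/-- The Oudom-Guin map as a linear equivalence. -/
def oudomGuinEquiv : Us ≃ₗ[k] U :=
  LinearEquiv.ofLinearMap P.oudomGuin P.oudomGuinInv
    (by
      ext a
      show P.oudomGuin (P.oudomGuinInv a) = a
      induction a using word_induction with
      | scalar r => rw [oudomGuinInv_algebraMap, oudomGuin_algebraMap]
      | add a b ha hb => simp only [map_add, ha, hb]
      | mul x a ha =>
        obtain ⟨x, rfl⟩ := P.ofSub.surjective x
        rw [oudomGuinInv_ι_mul, map_sub, oudomGuin_ι_mul, oudomGuin_coder, ha,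
          add_sub_cancel_right])
    (by
      ext u
      show P.oudomGuinInv (P.oudomGuin u) = u
      induction u using word_induction with
      | scalar r => rw [oudomGuin_algebraMap, oudomGuinInv_algebraMap]
      | add a b ha hb => simp only [map_add, ha, hb]
      | mul x u hu =>
        rw [oudomGuin_ι_mul, map_add, oudomGuinInv_ι_mul, oudomGuinInv_derLin, hu,
          sub_add_cancel])

/-! The coalgebra structure. -/

theorem counit_derLin (x a) : counit (R := k) (P.derLin x a) = 0 := by
  induction a using word_induction with
  | scalar r => simp
  | add a b ha hb => simp only [map_add, ha, hb, add_zero]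
  | mul y a ha => rw [derLin_ι_mul, map_add, UniversalEnvelopingAlgebra.counit_ι_mul,
      UniversalEnvelopingAlgebra.counit_ι_mul, add_zero]

/-- A derivation that maps primitive generators to primitive elements is a coderivation. -/
theorem comul_derLin (x a) : comul (R := k) (P.derLin x a) =
    (P.derLin x).rTensor U (comul (R := k) a) + (P.derLin x).lTensor U (comul (R := k) a) := by
  have key : ∀ (y : g) (z : U ⊗[k] U),
      (P.derLin x).rTensor U ((ι k y ⊗ₜ[k] 1 + 1 ⊗ₜ[k] ι k y) * z) +
        (P.derLin x).lTensor U ((ι k y ⊗ₜ[k] 1 + 1 ⊗ₜ[k] ι k y) * z) =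
      (ι k (P.tri (P.ofSub x) y) ⊗ₜ[k] 1 + 1 ⊗ₜ[k] ι k (P.tri (P.ofSub x) y)) * z +
      (ι k y ⊗ₜ[k] 1 + 1 ⊗ₜ[k] ι k y) *
        ((P.derLin x).rTensor U z + (P.derLin x).lTensor U z) := by
    intro y z
    induction z with
    | zero => simp
    | add a b ha hb =>
      simp only [mul_add, map_add] at ha hb ⊢
      rw [add_add_add_comm, ha, hb]; abel
    | tmul a b =>
      simp only [add_mul, mul_add, Algebra.TensorProduct.tmul_mul_tmul, one_mul, map_add,
        LinearMap.rTensor_tmul, LinearMap.lTensor_tmul, derLin_ι_mul, TensorProduct.add_tmul,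
        TensorProduct.tmul_add]
      abel
  induction a using word_induction with
  | scalar r => simp
  | add a b ha hb => simp only [map_add, ha, hb]; abel
  | mul y a ha =>
    rw [derLin_ι_mul, map_add, UniversalEnvelopingAlgebra.comul_ι_mul,
      UniversalEnvelopingAlgebra.comul_ι_mul, UniversalEnvelopingAlgebra.comul_ι_mul, key, ha]

theorem counit_oudomGuin (u) : counit (R := k) (P.oudomGuin u) = counit (R := k) u := by
  induction u using word_induction with
  | scalar r => rw [oudomGuin_algebraMap, UniversalEnvelopingAlgebra.counit_algebraMap,
      UniversalEnvelopingAlgebra.counit_algebraMap]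
  | add a b ha hb => simp only [map_add, ha, hb]
  | mul x a ha => rw [oudomGuin_ι_mul, map_add, UniversalEnvelopingAlgebra.counit_ι_mul,
      UniversalEnvelopingAlgebra.counit_ι_mul, counit_derLin, add_zero]

/-- On `U(g)`, both summands of `x · + x ▷` pass through the coproduct as diagonal operators. `Φ ⊗
Φ` carries multiplication by `Δ(x)` to the same diagonal operator, so both sides obey one recursion
on words. -/
theorem comul_oudomGuin (u) : TensorProduct.map P.oudomGuin P.oudomGuin (comul (R := k) u) =
    comul (R := k) (P.oudomGuin u) := by
  have key : ∀ (x : P.SubAdjacent) (z : Us ⊗[k] Us),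
      TensorProduct.map P.oudomGuin P.oudomGuin ((ι k x ⊗ₜ[k] 1 + 1 ⊗ₜ[k] ι k x) * z) =
      (ι k (P.ofSub x) ⊗ₜ[k] 1 + 1 ⊗ₜ[k] ι k (P.ofSub x)) *
        TensorProduct.map P.oudomGuin P.oudomGuin z +
      ((P.derLin x).rTensor U (TensorProduct.map P.oudomGuin P.oudomGuin z) +
        (P.derLin x).lTensor U (TensorProduct.map P.oudomGuin P.oudomGuin z)) := by
    intro x z
    induction z with
    | zero => simp
    | add a b ha hb =>
      rw [mul_add, map_add, ha, hb]
      simp only [mul_add, map_add]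
      abel
    | tmul a b =>
      simp only [add_mul, Algebra.TensorProduct.tmul_mul_tmul, one_mul, map_add,
        TensorProduct.map_tmul, oudomGuin_ι_mul,
        LinearMap.rTensor_tmul, LinearMap.lTensor_tmul, TensorProduct.add_tmul,
        TensorProduct.tmul_add]
      abel
  induction u using word_induction with
  | scalar r => rw [oudomGuin_algebraMap, UniversalEnvelopingAlgebra.comul_algebraMap,
      UniversalEnvelopingAlgebra.comul_algebraMap, TensorProduct.map_tmul, oudomGuin_algebraMap,
      oudomGuin_one]
  | add a b ha hb => simp only [map_add, ha, hb]
  | mul x a ha =>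
    rw [oudomGuin_ι_mul, map_add, UniversalEnvelopingAlgebra.comul_ι_mul,
      UniversalEnvelopingAlgebra.comul_ι_mul, comul_derLin, key, ha]

/-- The Oudom-Guin map as an isomorphism of coalgebras. -/
def oudomGuinCoalgEquiv : Us ≃ₗc[k] U where
  __ := P.oudomGuinEquiv
  counit_comp := LinearMap.ext P.counit_oudomGuin
  map_comp_comul := LinearMap.ext P.comul_oudomGuin

end PostLieAlgebra

/-- Renumbers an arbitrary decomposition by an initial segment of `ℕ`; the value `0` beyond the
segment never enters the sum. -/
theorem Sweedler.nonempty {R H : Type*} [CommSemiring R] [AddCommMonoid H] [Module R H]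
    [CoalgebraStruct R H] (x : H) : Nonempty (Sweedler R x) := by
  let s := Coalgebra.Repr.arbitrary R x
  let e := s.index.equivFin
  refine ⟨⟨Finset.range s.index.card,
    fun i => if h : i < s.index.card then s.left (e.symm ⟨i, h⟩) else 0,
    fun i => if h : i < s.index.card then s.right (e.symm ⟨i, h⟩) else 0, ?_⟩⟩
  rw [← s.eq, Finset.sum_range, ← Finset.sum_coe_sort s.index]
  exact Fintype.sum_equiv e.symm _ _ fun i => by simp

/-- The decomposition `Δ(x) = x ⊗ 1 + 1 ⊗ x` of a primitive element. -/
def Sweedler.ofPrimitive {R H : Type*} [CommSemiring R] [Semiring H] [Module R H]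
    [CoalgebraStruct R H] {x : H} (h : comul (R := R) x = x ⊗ₜ[R] 1 + 1 ⊗ₜ[R] x) :
    Sweedler R x where
  index := {0, 1}
  left i := if i = 0 then x else 1
  right i := if i = 0 then 1 else x
  eq := by rw [h, Finset.sum_pair (by decide)]; rfl

theorem Sweedler.sum_ofPrimitive {R H M : Type*} [CommSemiring R] [Semiring H] [Module R H]
    [CoalgebraStruct R H] [AddCommMonoid M] {x : H}
    (h : comul (R := R) x = x ⊗ₜ[R] 1 + 1 ⊗ₜ[R] x) (F : H → H → M) :
    ∑ i ∈ (Sweedler.ofPrimitive h).index, F ((Sweedler.ofPrimitive h).left i)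
      ((Sweedler.ofPrimitive h).right i) = F x 1 + F 1 x := by
  rw [Sweedler.ofPrimitive, Finset.sum_pair (by decide)]
  rfl

/-! ### Uniqueness of the product -/

namespace PostLieRinehart

variable {k R L : Type*} [CommRing k] [CommRing R] [Algebra k R] [LieRing L] [LieAlgebra R L]
  [Module k L] [IsScalarTower k R L]

/-- The elements of `U_R(L)` that are sums of words of length at most `n`. -/
inductive IsWordSum : ℕ → UniversalEnvelopingAlgebra R L → Prop
  | scalar (n : ℕ) (r : R) : IsWordSum n (algebraMap R _ r)
  | add {n : ℕ} {a b} (ha : IsWordSum n a) (hb : IsWordSum n b) : IsWordSum n (a + b)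
  | mul {n : ℕ} (x : L) {a} (ha : IsWordSum n a) : IsWordSum (n + 1) (ι R x * a)

theorem IsWordSum.succ {n : ℕ} {a : UniversalEnvelopingAlgebra R L} (h : IsWordSum n a) :
    IsWordSum (n + 1) a := by
  induction h with
  | scalar n r => exact .scalar _ r
  | add _ _ h1 h2 => exact h1.add h2
  | mul x _ h => exact h.mul x

theorem IsWordSum.mono {m n : ℕ} (hmn : m ≤ n) {a : UniversalEnvelopingAlgebra R L}
    (h : IsWordSum m a) : IsWordSum n a := by
  induction hmn with
  | refl => exact h
  | step _ ih => exact ih.succ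

theorem exists_isWordSum (a : UniversalEnvelopingAlgebra R L) : ∃ n, IsWordSum n a := by
  induction a using word_induction with
  | scalar r => exact ⟨0, .scalar 0 r⟩
  | add a b ha hb =>
    obtain ⟨m, hm⟩ := ha
    obtain ⟨n, hn⟩ := hb
    exact ⟨max m n, (hm.mono (le_max_left _ _)).add (hn.mono (le_max_right _ _))⟩
  | mul x a ha =>
    obtain ⟨n, hn⟩ := ha
    exact ⟨n + 1, hn.mul x⟩

/-- The rule for `xX ▷ Y` refers to `(x ▷ X) ▷ Y`, so induction on words is not enough by itself.
The operator `x ▷ ·` does not increase word length, however (`stable`), hence `x ▷ X` is still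
shorter than `xX` and induction on the length applies. -/
theorem IsEnvelopingProduct.unique [Module k (UniversalEnvelopingAlgebra R L)]
    {Q : PostLieRinehart k R L}
    {t t' : UniversalEnvelopingAlgebra R L →ₗ[k] UniversalEnvelopingAlgebra R L →ₗ[k]
      UniversalEnvelopingAlgebra R L}
    (h : Q.IsEnvelopingProduct fun X Y => t X Y) (h' : Q.IsEnvelopingProduct fun X Y => t' X Y) :
    t = t' := by
  have e : ∀ x X, t (ι R x) X = t' (ι R x) X := by
    intro x X
    induction X using word_induction with
    | scalar r => exact (h.tri_base x r).trans (h'.tri_base x r).symm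
    | add a b ha hb => rw [map_add, map_add, ha, hb]
    | mul y a ha => exact (h.tri_mul x y a).trans (by rw [ha]; exact (h'.tri_mul x y a).symm)
  have stable : ∀ x n X, IsWordSum n X → IsWordSum n (t (ι R x) X) := by
    intro x n X hX
    induction hX with
    | scalar n r => exact (h.tri_base x r) ▸ .scalar n _
    | add _ _ h1 h2 => rw [map_add]; exact h1.add h2
    | mul y ha hX => exact (h.tri_mul x y _) ▸ (ha.mul _).add (hX.mul y)
  have main : ∀ n X, IsWordSum n X → ∀ Y, t X Y = t' X Y := by
    intro n
    induction n with
    | zero =>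
      intro X hX Y
      generalize hn : 0 = n at hX
      induction hX with
      | scalar n r => exact (h.base_tri r Y).trans (h'.base_tri r Y).symm
      | add _ _ h1 h2 => rw [map_add, map_add, LinearMap.add_apply, LinearMap.add_apply, h1 hn,
          h2 hn]
      | mul => exact absurd hn.symm (Nat.succ_ne_zero _)
    | succ m ih =>
      intro X hX Y
      generalize hn : m + 1 = n at hX
      induction hX with
      | scalar n r => exact (h.base_tri r Y).trans (h'.base_tri r Y).symm
      | add _ _ h1 h2 => rw [map_add, map_add, LinearMap.add_apply, LinearMap.add_apply, h1 hn,
          h2 hn]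
      | mul x ha =>
        obtain rfl : m = _ := Nat.succ_injective hn
        refine (h.mul_tri x _ Y).trans (Eq.trans ?_ (h'.mul_tri x _ Y).symm)
        show t (ι R x) (t _ Y) - t (t (ι R x) _) Y = t' (ι R x) (t' _ Y) - t' (t' (ι R x) _) Y
        rw [ih _ (stable x _ _ ha), ih _ ha, e, e]
  exact LinearMap.ext fun X => LinearMap.ext fun Y => (exists_isWordSum X).elim fun n hn =>
    main n X hn Y

end PostLieRinehart

/-! ### The post-Hopf algebra `U(g)` -/

namespace PostLieAlgebra

variable {k g : Type*} [CommRing k] [LieRing g] [LieAlgebra k g] (P : PostLieAlgebra k g)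

local notation "U" => UniversalEnvelopingAlgebra k g
local notation "Us" => UniversalEnvelopingAlgebra k P.SubAdjacent

theorem act_mul {I : Type*} {u : Us} (s : Coalgebra.Repr k u I) (a b : U) :
    P.act u (a * b) = ∑ i ∈ s.index, P.act (s.left i) a * P.act (s.right i) b :=
  UniversalEnvelopingAlgebra.map_bilin_eq_sum (LinearMap.mul k U)
    (fun x v w => by simp only [act_ι, LinearMap.mul_apply', derLin_mul]) s a b

/-- On a generator, `x(ab) + x ▷ (ab) = (xa + x ▷ a) b + a (x ▷ b)`: left multiplication meets only
the first factor. For `a = 1` this is the Grossman-Larson formula. -/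
theorem mulAct_mul {I : Type*} {u : Us} (s : Coalgebra.Repr k u I) (a b : U) :
    P.mulAct u (a * b) = ∑ i ∈ s.index, P.mulAct (s.left i) a * P.act (s.right i) b :=
  UniversalEnvelopingAlgebra.map_bilin_eq_sum (LinearMap.mul k U)
    (fun x v w => by
      simp only [act_ι, mulAct_ι, LinearMap.mul_apply', derLin_mul]; noncomm_ring) s a b

theorem mulAct_eq_sum {I : Type*} {u : Us} (s : Coalgebra.Repr k u I) (b : U) :
    P.mulAct u b = ∑ i ∈ s.index, P.oudomGuin (s.left i) * P.act (s.right i) b := by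
  simpa only [one_mul, oudomGuin_apply] using P.mulAct_mul s 1 b

/-- The action of `g_▷` on `U(g) ⊗ U(g)`. -/
def derTensor : P.SubAdjacent →ₗ⁅k⁆ Module.End k (U ⊗[k] U) where
  toFun x := (P.derLin x).rTensor U + (P.derLin x).lTensor U
  map_add' x y := by
    rw [map_add, LinearMap.rTensor_add, LinearMap.lTensor_add]; abel
  map_smul' c x := by
    rw [map_smul, LinearMap.rTensor_smul, LinearMap.lTensor_smul, RingHom.id_apply, smul_add]
  map_lie' {x y} := by
    have h : ∀ a, P.derLin ⁅x, y⁆ a = P.derLin x (P.derLin y a) - P.derLin y (P.derLin x a) :=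
      LinearMap.congr_fun (P.der.map_lie x y)
    refine TensorProduct.ext' fun a b => ?_
    simp only [LieRing.of_associative_ring_bracket, LinearMap.add_apply, LinearMap.sub_apply,
      Module.End.mul_apply, LinearMap.rTensor_tmul, LinearMap.lTensor_tmul, map_add, h,
      TensorProduct.sub_tmul, TensorProduct.tmul_sub]
    abel

theorem comul_act {I J : Type*} {u : Us} {a : U} (s : Coalgebra.Repr k u I)
    (t : Coalgebra.Repr k a J) : comul (R := k) (P.act u a) =
      ∑ i ∈ s.index, ∑ j ∈ t.index,
        P.act (s.left i) (t.left j) ⊗ₜ[k] P.act (s.right i) (t.right j) := by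
  -- The coproduct intertwines `act` with the diagonal action `E`, because generators act by
  -- coderivations. The Leibniz principle then expands `E u` on pure tensors.
  let E := UniversalEnvelopingAlgebra.lift k P.derTensor
  have hE : ∀ x z, E (ι k x) z = (P.derLin x).rTensor U z + (P.derLin x).lTensor U z := by
    intro x z
    rw [UniversalEnvelopingAlgebra.lift_ι_apply]
    rfl
  have h : comul (R := k) (P.act u a) = E u (comul (R := k) a) := by
    clear s
    induction u using word_induction with
    | scalar r => simp [Module.algebraMap_end_apply]
    | add u v hu hv => simp only [map_add, LinearMap.add_apply, hu, hv]
    | mul x u hu =>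
      rw [map_mul, Module.End.mul_apply, act_ι, comul_derLin, hu, map_mul, Module.End.mul_apply, hE]
  rw [h, ← t.eq, map_sum, Finset.sum_comm]
  refine Finset.sum_congr rfl fun j _ => ?_
  exact UniversalEnvelopingAlgebra.map_bilin_eq_sum (TensorProduct.mk k U U)
    (fun x v w => by simp only [hE, TensorProduct.mk_apply, LinearMap.rTensor_tmul,
      LinearMap.lTensor_tmul, act_ι]) s _ _

theorem counit_act (u : Us) (a : U) :
    counit (R := k) (P.act u a) = counit (R := k) u * counit (R := k) a := by
  induction u using word_induction with
  | scalar r => simp [Module.algebraMap_end_apply]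
  | add u v hu hv => simp only [map_add, LinearMap.add_apply, hu, hv, add_mul]
  | mul x u hu => rw [map_mul, Module.End.mul_apply, act_ι, counit_derLin,
      UniversalEnvelopingAlgebra.counit_ι_mul, zero_mul]

theorem oudomGuin_mul_eq_sum {I : Type*} {u : Us} (s : Coalgebra.Repr k u I) (v : Us) :
    P.oudomGuin (u * v) =
      ∑ i ∈ s.index, P.oudomGuin (s.left i) * P.act (s.right i) (P.oudomGuin v) := by
  rw [oudomGuin_mul, mulAct_eq_sum P s]

theorem oudomGuin_symm (X : U) : P.oudomGuin (P.oudomGuinCoalgEquiv.symm X) = X :=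
  P.oudomGuinCoalgEquiv.apply_symm_apply X

theorem symm_oudomGuin (u : Us) : P.oudomGuinCoalgEquiv.symm (P.oudomGuin u) = u :=
  P.oudomGuinCoalgEquiv.symm_apply_apply u

theorem oudomGuin_surjective : Function.Surjective P.oudomGuin := fun X =>
  ⟨_, P.oudomGuin_symm X⟩

theorem counit_symm (X : U) :
    counit (R := k) (P.oudomGuinCoalgEquiv.symm X) = counit (R := k) X :=
  CoalgHomClass.counit_comp_apply P.oudomGuinCoalgEquiv.symm X

/-- The post-Hopf algebra structure of `U(g)`. -/
def postHopfAlgebra : PostHopfAlgebra k U where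
  tri := P.act.toLinearMap ∘ₗ P.oudomGuinCoalgEquiv.symm.toLinearEquiv.toLinearMap
  -- A representation composed with the antipode is its convolution inverse.
  beta := P.act.toLinearMap ∘ₗ antipode k ∘ₗ P.oudomGuinCoalgEquiv.symm.toLinearEquiv.toLinearMap
  comul_tri x y sx sy := P.comul_act (sx.induced P.oudomGuinCoalgEquiv.symm) sy
  counit_tri x y := (P.counit_act _ _).trans (by rw [← P.counit_symm x]; rfl)
  tri_mul x y z s := P.act_mul (s.induced P.oudomGuinCoalgEquiv.symm) y z
  -- For `x = Φ(u)` and `y = Φ(v)` the sum on the right is `Φ(uv)`, so the axiom is multiplicativity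
  -- of `act`.
  tri_tri x y z s := by
    have h := P.oudomGuin_mul_eq_sum (s.induced P.oudomGuinCoalgEquiv.symm)
      (P.oudomGuinCoalgEquiv.symm y)
    rw [oudomGuin_symm] at h
    have h' := congrArg (fun t => P.act (P.oudomGuinCoalgEquiv.symm t) z) h
    beta_reduce at h'
    rw [symm_oudomGuin, map_mul, Module.End.mul_apply] at h'
    refine h'.trans ?_
    simp only [Coalgebra.Repr.induced, Function.comp_apply, oudomGuin_symm]
    rfl
  tri_beta x y s := by
    have h := congrArg (P.act · y) (HopfAlgebra.sum_mul_antipode_eq_algebraMap_counit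
      (s.induced P.oudomGuinCoalgEquiv.symm))
    beta_reduce at h
    rw [AlgHom.commutes, Module.algebraMap_end_apply, counit_symm] at h
    rw [← h, map_sum, LinearMap.sum_apply]
    simp only [map_mul]
    rfl
  beta_tri x y s := by
    have h := congrArg (P.act · y) (HopfAlgebra.sum_antipode_mul_eq_algebraMap_counit
      (s.induced P.oudomGuinCoalgEquiv.symm))
    beta_reduce at h
    rw [AlgHom.commutes, Module.algebraMap_end_apply, counit_symm] at h
    rw [← h, map_sum, LinearMap.sum_apply]
    simp only [map_mul]
    rfl

theorem postHopfAlgebra_tri (u : Us) (a : U) :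
    P.postHopfAlgebra.tri (P.oudomGuin u) a = P.act u a :=
  congrArg (P.act · a) (P.symm_oudomGuin u)

theorem postHopfAlgebra_beta (u : Us) (a : U) :
    P.postHopfAlgebra.beta (P.oudomGuin u) a = P.act (antipode k u) a :=
  congrArg (fun v => P.act (antipode k v) a) (P.symm_oudomGuin u)

theorem postHopfAlgebra_glMul (u : Us) (b : U) :
    P.postHopfAlgebra.glMul (P.oudomGuin u) b = P.mulAct u b := by
  obtain ⟨s⟩ := Sweedler.nonempty (R := k) u
  rw [P.mulAct_eq_sum s]
  refine (P.postHopfAlgebra.glMul_eq _ _ (s.induced P.oudomGuinCoalgEquiv)).trans ?_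
  exact Finset.sum_congr rfl fun i _ => congrArg (_ * ·) (P.postHopfAlgebra_tri _ b)

/-- The Oudom-Guin isomorphism onto the sub-adjacent Hopf algebra of `U(g)`. -/
def oudomGuinIso : OudomGuinIso P P.postHopfAlgebra where
  equiv := P.oudomGuinCoalgEquiv
  map_one := P.oudomGuin_one
  map_mul X Y := (P.oudomGuin_mul X Y).trans (P.postHopfAlgebra_glMul X _).symm
  map_ι := P.oudomGuin_ι

theorem isEnvelopingProduct_postHopfAlgebra :
    P.toPostLieRinehart.IsEnvelopingProduct fun X Y => P.postHopfAlgebra.tri X Y where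
  base_tri f X := by
    show P.postHopfAlgebra.tri (algebraMap k U f) X = _
    rw [← oudomGuin_algebraMap, postHopfAlgebra_tri, AlgHom.commutes, Module.algebraMap_end_apply,
      oudomGuin_algebraMap, Algebra.smul_def]
  tri_base x f := by
    obtain ⟨x, rfl⟩ := P.ofSub.surjective x
    show P.postHopfAlgebra.tri (ι k (P.ofSub x)) _ = algebraMap k U 0
    rw [← oudomGuin_ι, postHopfAlgebra_tri, act_ι, derLin_algebraMap, map_zero]
  tri_ι x y := by
    obtain ⟨x, rfl⟩ := P.ofSub.surjective x
    show P.postHopfAlgebra.tri (ι k (P.ofSub x)) _ = ι k (P.tri (P.ofSub x) y)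
    rw [← oudomGuin_ι, postHopfAlgebra_tri, act_ι, derLin_ι]
  tri_mul x y X := by
    obtain ⟨x, rfl⟩ := P.ofSub.surjective x
    show P.postHopfAlgebra.tri (ι k (P.ofSub x)) _ = ι k (P.tri (P.ofSub x) y) * X +
      ι k y * P.postHopfAlgebra.tri (ι k (P.ofSub x)) X
    rw [← oudomGuin_ι, postHopfAlgebra_tri, postHopfAlgebra_tri, act_ι, act_ι, derLin_ι_mul]
  mul_tri x X Y := by
    obtain ⟨x, rfl⟩ := P.ofSub.surjective x
    obtain ⟨u, rfl⟩ := P.oudomGuin_surjective X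
    show P.postHopfAlgebra.tri (ι k (P.ofSub x) * P.oudomGuin u) Y =
      P.postHopfAlgebra.tri (ι k (P.ofSub x)) (P.postHopfAlgebra.tri (P.oudomGuin u) Y) -
      P.postHopfAlgebra.tri (P.postHopfAlgebra.tri (ι k (P.ofSub x)) (P.oudomGuin u)) Y
    -- The recursion is `xX = x * X - x ▷ X` with `*` the Grossman-Larson product, on which `act` is
    -- multiplicative.
    have h : ι k (P.ofSub x) * P.oudomGuin u = P.oudomGuin (ι k x * u) -
        P.derLin x (P.oudomGuin u) := by
      rw [oudomGuin_ι_mul, add_sub_cancel_right]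
    rw [h, map_sub, LinearMap.sub_apply]
    simp only [← oudomGuin_ι, postHopfAlgebra_tri, map_mul, Module.End.mul_apply, act_ι]

/-- The antipode is the anti-automorphism that is `-1` on `g`, so it commutes with every derivation
that preserves `g`. -/
theorem derLin_antipode (x : P.SubAdjacent) (a : U) :
    P.derLin x (antipode k a) = antipode k (P.derLin x a) := by
  induction a using word_induction with
  | scalar r => rw [UniversalEnvelopingAlgebra.antipode_algebraMap, derLin_algebraMap, map_zero]
  | add a b ha hb => simp only [map_add, ha, hb]
  | mul y a ha =>
    rw [derLin_ι_mul, map_add, UniversalEnvelopingAlgebra.antipode_ι_mul,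
      UniversalEnvelopingAlgebra.antipode_ι_mul, UniversalEnvelopingAlgebra.antipode_ι_mul,
      map_neg, derLin_mul, derLin_ι, ha, neg_add, add_comm]

/-- The antipode of the sub-adjacent Hopf algebra is the one of `U(g_▷)`. -/
theorem subAntipode_oudomGuin (u : Us) :
    P.postHopfAlgebra.subAntipode (P.oudomGuin u) = P.oudomGuin (antipode k u) := by
  -- The claim is the case `b = 1`. The free factor `b` is needed because removing a generator `x`
  -- from `u` replaces `b` by `x b + x ▷ b`, up to sign; the terms with `x ▷ Φ(q)` cancel.
  let F (b : U) : Us ⊗[k] Us →ₗ[k] U := TensorProduct.lift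
    ((P.act.toLinearMap ∘ₗ antipode k).compl₂
      ((LinearMap.mul k U).flip b ∘ₗ antipode k ∘ₗ P.oudomGuin))
  have hF : ∀ b p q, F b (p ⊗ₜ q) = P.act (antipode k p) (antipode k (P.oudomGuin q) * b) :=
    fun _ _ _ => rfl
  have key : ∀ (x : P.SubAdjacent) b z, F b ((ι k x ⊗ₜ[k] 1 + 1 ⊗ₜ[k] ι k x) * z) =
      -F (P.mulAct (ι k x) b) z := by
    intro x b z
    induction z with
    | zero => simp
    | add z w hz hw => rw [mul_add, map_add, hz, hw, map_add, neg_add]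
    | tmul p q =>
      rw [add_mul, Algebra.TensorProduct.tmul_mul_tmul, Algebra.TensorProduct.tmul_mul_tmul,
        one_mul, one_mul, map_add, hF, hF, hF, UniversalEnvelopingAlgebra.antipode_ι_mul, map_neg,
        LinearMap.neg_apply, map_mul P.act, Module.End.mul_apply, act_ι, derLin_mul, derLin_antipode,
        oudomGuin_ι_mul, map_add (antipode k), UniversalEnvelopingAlgebra.antipode_ι_mul, mulAct_ι]
      simp only [add_mul, mul_add, neg_mul, map_add, map_neg, mul_assoc]
      abel
  have main : ∀ b, F b (comul (R := k) u) = P.mulAct (antipode k u) b := by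
    induction u using word_induction with
    | scalar r =>
      intro b
      rw [UniversalEnvelopingAlgebra.comul_algebraMap, hF, oudomGuin_one, HopfAlgebra.antipode_one,
        one_mul, UniversalEnvelopingAlgebra.antipode_algebraMap, AlgHom.commutes, AlgHom.commutes]
    | add a b ha hb => intro c; simp only [map_add, LinearMap.add_apply, ha, hb]
    | mul x a ha =>
      intro b
      rw [UniversalEnvelopingAlgebra.comul_ι_mul, key, ha,
        UniversalEnvelopingAlgebra.antipode_ι_mul, map_neg, map_mul]
      rfl
  rw [P.oudomGuin_apply (antipode k u), ← main]
  obtain ⟨s⟩ := Sweedler.nonempty (R := k) u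
  rw [← s.eq, map_sum]
  refine (P.postHopfAlgebra.subAntipode_eq _ (s.induced P.oudomGuinCoalgEquiv)).trans ?_
  refine Finset.sum_congr rfl fun i _ => ?_
  rw [hF, mul_one]
  exact P.postHopfAlgebra_beta _ _

/-! ### The action of `U(g)` on `R` -/

section Action

variable {R : Type*} [CommRing R] [Algebra k R] (ρ : P.SubAdjacent →ₗ⁅k⁆ Derivation k R R)

theorem liftDer_ι (x f) : liftDer P ρ (ι k x) f = ρ x f := by
  rw [liftDer, UniversalEnvelopingAlgebra.lift_ι_apply]
  rfl

theorem oudomGuinIso_act (u : Us) (f : R) :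
    P.oudomGuinIso.act ρ (P.oudomGuin u) f = liftDer P ρ u f :=
  congrArg (liftDer P ρ · f) (P.symm_oudomGuin u)

theorem liftDer_one (u : Us) : liftDer P ρ u 1 = algebraMap k R (counit (R := k) u) := by
  induction u using word_induction with
  | scalar r => simp [Algebra.algebraMap_eq_smul_one]
  | add u v hu hv => simp only [map_add, LinearMap.add_apply, hu, hv]
  | mul x u hu =>
    rw [map_mul, Module.End.mul_apply, hu, liftDer_ι, Derivation.map_algebraMap,
      UniversalEnvelopingAlgebra.counit_ι_mul, map_zero]

theorem liftDer_mul {I : Type*} {u : Us} (s : Coalgebra.Repr k u I) (f f' : R) :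
    liftDer P ρ u (f * f') =
      ∑ i ∈ s.index, liftDer P ρ (s.left i) f * liftDer P ρ (s.right i) f' :=
  UniversalEnvelopingAlgebra.map_bilin_eq_sum (LinearMap.mul k R)
    (fun x v w => by
      simp only [liftDer_ι, LinearMap.mul_apply', Derivation.leibniz, smul_eq_mul]; ring) s f f'

theorem isModuleAlgebra : P.postHopfAlgebra.IsModuleAlgebra (P.oudomGuinIso.act ρ) where
  glMul_act x y f := by
    obtain ⟨u, rfl⟩ := P.oudomGuin_surjective x
    obtain ⟨v, rfl⟩ := P.oudomGuin_surjective y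
    rw [postHopfAlgebra_glMul, ← oudomGuin_mul, oudomGuinIso_act, oudomGuinIso_act,
      oudomGuinIso_act, map_mul, Module.End.mul_apply]
  one_act f := by rw [← oudomGuin_one, oudomGuinIso_act, map_one, Module.End.one_apply]
  act_mul x f f' s := P.liftDer_mul ρ (s.induced P.oudomGuinCoalgEquiv.symm) f f'
  act_one x := by
    obtain ⟨u, rfl⟩ := P.oudomGuin_surjective x
    rw [oudomGuinIso_act, liftDer_one, counit_oudomGuin]

end Action

end PostLieAlgebra

/-! ### The action post-Hopf algebroid `R ⊗ U(g)` -/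

namespace PostLieAlgebra

variable {k R g : Type*} [CommRing k] [CommRing R] [Algebra k R] [LieRing g] [LieAlgebra k g]
  (P : PostLieAlgebra k g) (ρ : P.SubAdjacent →ₗ⁅k⁆ Derivation k R R)

local notation "U" => UniversalEnvelopingAlgebra k g
local notation "Us" => UniversalEnvelopingAlgebra k P.SubAdjacent
local notation "H" => R ⊗[k] UniversalEnvelopingAlgebra k g

/-! ### Tensor products of representations with `R` -/

section TensorAction

variable {W : Type*} [AddCommGroup W] [Module k W] (d : P.SubAdjacent →ₗ⁅k⁆ Module.End k W)

/-- The tensor product of the action `ρ` on `R` and an action on `W`. -/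
def tensorLie : P.SubAdjacent →ₗ⁅k⁆ Module.End k (R ⊗[k] W) where
  toFun x := LinearMap.rTensor W (ρ x : R →ₗ[k] R) + LinearMap.lTensor R (d x)
  map_add' x y := by
    simp only [map_add, Derivation.coe_add_linearMap, LinearMap.rTensor_add,
      LinearMap.lTensor_add]
    abel
  map_smul' c x := by
    simp only [map_smul, Derivation.coe_smul_linearMap, LinearMap.rTensor_smul,
      LinearMap.lTensor_smul, RingHom.id_apply, smul_add]
  map_lie' {x y} := by
    refine TensorProduct.ext' fun a b => ?_
    simp only [LieRing.of_associative_ring_bracket, LinearMap.add_apply, LinearMap.sub_apply,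
      Module.End.mul_apply, LinearMap.rTensor_tmul, LinearMap.lTensor_tmul, map_add,
      Derivation.coeFn_coe, Derivation.commutator_apply, LieHom.map_lie,
      TensorProduct.sub_tmul, TensorProduct.tmul_sub]
    abel

/-- The action of `U(g_▷)` on `R ⊗ W`. -/
def tensorAct : Us →ₐ[k] Module.End k (R ⊗[k] W) :=
  UniversalEnvelopingAlgebra.lift k (P.tensorLie ρ d)

theorem tensorAct_ι_tmul (x f w) : P.tensorAct ρ d (ι k x) (f ⊗ₜ w) =
    ρ x f ⊗ₜ w + f ⊗ₜ d x w := by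
  rw [tensorAct, UniversalEnvelopingAlgebra.lift_ι_apply]
  rfl

theorem tensorAct_tmul {I : Type*} {u : Us} (s : Coalgebra.Repr k u I) (f : R) (w : W) :
    P.tensorAct ρ d u (f ⊗ₜ w) = ∑ i ∈ s.index,
      liftDer P ρ (s.left i) f ⊗ₜ[k] UniversalEnvelopingAlgebra.lift k d (s.right i) w :=
  UniversalEnvelopingAlgebra.map_bilin_eq_sum (TensorProduct.mk k R W)
    (fun x f w => by
      simp only [TensorProduct.mk_apply, tensorAct_ι_tmul, liftDer_ι,
        UniversalEnvelopingAlgebra.lift_ι_apply]) s f w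

theorem tensorAct_one_tmul (u : Us) (w : W) :
    P.tensorAct ρ d u ((1 : R) ⊗ₜ w) = 1 ⊗ₜ UniversalEnvelopingAlgebra.lift k d u w := by
  induction u using word_induction with
  | scalar r => simp only [AlgHom.commutes, Module.algebraMap_end_apply, TensorProduct.tmul_smul]
  | add u v hu hv => simp only [map_add, LinearMap.add_apply, hu, hv, TensorProduct.tmul_add]
  | mul x u hu =>
    rw [map_mul, Module.End.mul_apply, hu, tensorAct_ι_tmul, Derivation.map_one_eq_zero,
      TensorProduct.zero_tmul, zero_add, UniversalEnvelopingAlgebra.lift_ι_mul]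
    rfl

end TensorAction

/-! ### Representations compatible with the module structure over `R` -/

section Twisted

variable {V : Type*} [AddCommGroup V] [Module R V] [Module k V] [IsScalarTower k R V]

/-- An action of `U(g_▷)` on an `R`-module that is compatible with the action on `R`. -/
def IsTwisted (N : Us →ₐ[k] Module.End k V) : Prop :=
  ∀ (x : P.SubAdjacent) (r : R) (v : V), N (ι k x) (r • v) = ρ x r • v + r • N (ι k x) v

theorem isTwisted_tensorAct {W : Type*} [AddCommGroup W] [Module k W]
    (d : P.SubAdjacent →ₗ⁅k⁆ Module.End k W) : P.IsTwisted ρ (P.tensorAct ρ d) := by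
  intro x r v
  induction v with
  | zero => simp
  | add v w hv hw => simp only [smul_add, map_add, hv, hw]; abel
  | tmul f w =>
    simp only [TensorProduct.smul_tmul', tensorAct_ι_tmul, smul_eq_mul, Derivation.leibniz,
      TensorProduct.add_tmul, smul_add, mul_comm f]
    abel

/-- The `R`-linear extension `f ⊗ Φ(u) ↦ f N(u)` of an action of `U(g_▷)`. -/
def hat (N : Us →ₐ[k] Module.End k V) : H →ₗ[R] Module.End k V :=
  LinearMap.liftBaseChange R
    (N.toLinearMap ∘ₗ P.oudomGuinCoalgEquiv.symm.toLinearEquiv.toLinearMap)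

theorem hat_tmul (N : Us →ₐ[k] Module.End k V) (f : R) (u : Us) (v : V) :
    P.hat N (f ⊗ₜ P.oudomGuin u) v = f • N u v := by
  show (f • N (P.oudomGuinCoalgEquiv.symm (P.oudomGuin u))) v = _
  rw [symm_oudomGuin, LinearMap.smul_apply]

theorem hat_tmul_one (N : Us →ₐ[k] Module.End k V) (f : R) (v : V) :
    P.hat N (f ⊗ₜ 1) v = f • v := by
  rw [← oudomGuin_one, hat_tmul, map_one, Module.End.one_apply]

/-- Evaluation of `hat` as an `R`-linear map. -/
def hatApply (N : Us →ₐ[k] Module.End k V) (v : V) : H →ₗ[R] V where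
  toFun X := P.hat N X v
  map_add' X Y := by rw [map_add, LinearMap.add_apply]
  map_smul' r X := by rw [map_smul, LinearMap.smul_apply, RingHom.id_apply]

theorem hatApply_apply (N : Us →ₐ[k] Module.End k V) (v : V) (X : H) :
    P.hatApply N v X = P.hat N X v := rfl

/-- The tensor product over `R` of a compatible action with itself, on generators. -/
def tensorSquareLin (N : Us →ₐ[k] Module.End k V) (hN : P.IsTwisted ρ N) (x : P.SubAdjacent) :
    Module.End k (V ⊗[R] V) :=
  -- Neither summand is balanced over `R`, but their sum is. Moving `r` across the tensor sign moves
  -- the extra term `ρ(x)(r) v ⊗ w` from the first summand to the second.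
  let T : V ⊗[R] V →+ V ⊗[R] V := TensorProduct.liftAddHom
    (AddMonoidHom.mk' (fun v => AddMonoidHom.mk'
      (fun w => N (ι k x) v ⊗ₜ[R] w + v ⊗ₜ[R] N (ι k x) w)
      (fun w w' => by simp only [map_add, TensorProduct.tmul_add]; abel))
      (fun v v' => by
        ext w
        simp only [map_add, TensorProduct.add_tmul, AddMonoidHom.mk'_apply,
          AddMonoidHom.add_apply]
        abel))
    (fun r v w => by
      simp only [AddMonoidHom.mk'_apply, hN x, TensorProduct.add_tmul, TensorProduct.tmul_add,
        TensorProduct.smul_tmul]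
      abel)
  { T with
    map_smul' := fun c z => by
      show T (c • z) = c • T z
      induction z with
      | zero => simp
      | add z w hz hw => simp only [smul_add, map_add, hz, hw]
      | tmul v w =>
        rw [TensorProduct.smul_tmul']
        show N (ι k x) (c • v) ⊗ₜ[R] w + (c • v) ⊗ₜ[R] N (ι k x) w =
          c • (N (ι k x) v ⊗ₜ[R] w + v ⊗ₜ[R] N (ι k x) w)
        rw [map_smul, smul_add, TensorProduct.smul_tmul', TensorProduct.smul_tmul'] }

theorem tensorSquareLin_tmul (N : Us →ₐ[k] Module.End k V) (hN : P.IsTwisted ρ N)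
    (x : P.SubAdjacent) (v w : V) : P.tensorSquareLin ρ N hN x (v ⊗ₜ w) =
      N (ι k x) v ⊗ₜ[R] w + v ⊗ₜ[R] N (ι k x) w := rfl

theorem end_ext_tmul {f f' : Module.End k (V ⊗[R] V)}
    (h : ∀ v w, f (v ⊗ₜ w) = f' (v ⊗ₜ w)) : f = f' := by
  ext z
  induction z with
  | zero => simp
  | add z w hz hw => rw [map_add, map_add, hz, hw]
  | tmul v w => exact h v w

/-- The tensor product over `R` of a compatible action with itself. -/
def tensorSquare (N : Us →ₐ[k] Module.End k V) (hN : P.IsTwisted ρ N) :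
    Us →ₐ[k] Module.End k (V ⊗[R] V) :=
  UniversalEnvelopingAlgebra.lift k
    { toFun := P.tensorSquareLin ρ N hN
      map_add' := fun x y => end_ext_tmul fun v w => by
        simp only [LinearMap.add_apply, tensorSquareLin_tmul, map_add, TensorProduct.add_tmul,
          TensorProduct.tmul_add]
        abel
      map_smul' := fun c x => end_ext_tmul fun v w => by
        simp only [LinearMap.smul_apply, tensorSquareLin_tmul, map_smul, RingHom.id_apply,
          smul_add, TensorProduct.smul_tmul', TensorProduct.tmul_smul]
      map_lie' := fun {x y} => end_ext_tmul fun v w => by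
        simp only [LieRing.of_associative_ring_bracket, LinearMap.sub_apply,
          Module.End.mul_apply, tensorSquareLin_tmul, map_add, LieHom.map_lie, map_sub, map_mul,
          TensorProduct.sub_tmul, TensorProduct.tmul_sub]
        abel }

theorem tensorSquare_ι (N : Us →ₐ[k] Module.End k V) (hN : P.IsTwisted ρ N)
    (x : P.SubAdjacent) : P.tensorSquare ρ N hN (ι k x) = P.tensorSquareLin ρ N hN x := by
  rw [tensorSquare, UniversalEnvelopingAlgebra.lift_ι_apply]
  rfl

theorem tensorSquare_tmul (N : Us →ₐ[k] Module.End k V) (hN : P.IsTwisted ρ N) {I : Type*}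
    {u : Us} (s : Coalgebra.Repr k u I) (v w : V) : P.tensorSquare ρ N hN u (v ⊗ₜ w) =
      ∑ i ∈ s.index, N (s.left i) v ⊗ₜ[R] N (s.right i) w :=
  UniversalEnvelopingAlgebra.map_bilin_eq_sum
    (LinearMap.mk₂ k (fun v w => v ⊗ₜ[R] w) (fun _ _ _ => TensorProduct.add_tmul _ _ _)
      (fun _ _ _ => rfl) (fun _ _ _ => TensorProduct.tmul_add _ _ _)
      (fun _ _ _ => TensorProduct.tmul_smul _ _ _))
    (fun x v w => by rw [tensorSquare_ι]; rfl) s v w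

end Twisted

theorem tensor_induction {p : H → Prop} (add : ∀ X Y, p X → p Y → p (X + Y))
    (tmul : ∀ f u, p (f ⊗ₜ P.oudomGuin u)) (X : H) : p X := by
  induction X with
  | zero => simpa using tmul 0 0
  | add X Y hX hY => exact add X Y hX hY
  | tmul f a =>
    obtain ⟨u, rfl⟩ := P.oudomGuin_surjective a
    exact tmul f u

/-- The action of `U(g_▷)` on `R ⊗ U(g)` by `ρ` and the derivations `x ▷ ·`. -/
def actH : Us →ₐ[k] Module.End k H := P.tensorAct ρ P.der

/-- The action of `U(g_▷)` on `R ⊗ U(g)` by `ρ` and `x · + x ▷ ·`. -/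
def mulActH : Us →ₐ[k] Module.End k H := P.tensorAct ρ P.mulDer

theorem isTwisted_actH : P.IsTwisted ρ (P.actH ρ) := P.isTwisted_tensorAct ρ _

theorem isTwisted_mulActH : P.IsTwisted ρ (P.mulActH ρ) := P.isTwisted_tensorAct ρ _

theorem actH_ι_tmul (x f a) : P.actH ρ (ι k x) (f ⊗ₜ a) = ρ x f ⊗ₜ a + f ⊗ₜ P.derLin x a :=
  P.tensorAct_ι_tmul ρ _ x f a

theorem mulActH_ι_tmul (x f a) : P.mulActH ρ (ι k x) (f ⊗ₜ a) =
    ρ x f ⊗ₜ a + f ⊗ₜ (ι k (P.ofSub x) * a + P.derLin x a) :=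
  P.tensorAct_ι_tmul ρ _ x f a

theorem mulActH_one_tmul_oudomGuin (u v : Us) :
    P.mulActH ρ u ((1 : R) ⊗ₜ P.oudomGuin v) = 1 ⊗ₜ P.oudomGuin (u * v) := by
  rw [oudomGuin_mul]
  exact P.tensorAct_one_tmul ρ _ u _

theorem mulActH_ι_tmul_oudomGuin (x f) (v : Us) : P.mulActH ρ (ι k x) (f ⊗ₜ P.oudomGuin v) =
    ρ x f ⊗ₜ P.oudomGuin v + f ⊗ₜ P.oudomGuin (ι k x * v) := by
  rw [mulActH_ι_tmul, oudomGuin_ι_mul]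

section Twisted

variable {V : Type*} [AddCommGroup V] [Module R V] [Module k V] [IsScalarTower k R V]

/-- For a generator, `x * (f Φ(w)) = ρ(x)(f) Φ(w) + f Φ(xw)`. Applying `N`, this is the composite of
`N x` and `f N(w)`, by the twist condition. -/
theorem hat_mulActH {N : Us →ₐ[k] Module.End k V} (hN : P.IsTwisted ρ N) (u : Us) (Y : H) (v : V) :
    P.hat N (P.mulActH ρ u Y) v = N u (P.hat N Y v) := by
  induction u using word_induction generalizing Y with
  | scalar r =>
    rw [AlgHom.commutes, AlgHom.commutes, Module.algebraMap_end_apply,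
      Module.algebraMap_end_apply, ← algebraMap_smul R, map_smul, LinearMap.smul_apply,
      algebraMap_smul]
  | add u w hu hw => simp only [map_add, LinearMap.add_apply, hu, hw]
  | mul x u hu =>
    rw [map_mul, Module.End.mul_apply, map_mul, Module.End.mul_apply, ← hu]
    generalize P.mulActH ρ u Y = Z
    induction Z using P.tensor_induction with
    | add X Y hX hY => simp only [map_add, LinearMap.add_apply, hX, hY]
    | tmul f w =>
      rw [mulActH_ι_tmul_oudomGuin, map_add, LinearMap.add_apply, hat_tmul, hat_tmul, hat_tmul,
        hN x, map_mul, Module.End.mul_apply]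

/-- `hat N` turns the product `hat mulActH` into composition of operators. This one fact yields both
associativity of the Grossman-Larson product and the axiom `tri_tri`. -/
theorem hat_hat {N : Us →ₐ[k] Module.End k V} (hN : P.IsTwisted ρ N) (X Y : H) (v : V) :
    P.hat N (P.hat (P.mulActH ρ) X Y) v = P.hat N X (P.hat N Y v) := by
  induction X using P.tensor_induction with
  | add X X' hX hX' => simp only [map_add, LinearMap.add_apply, hX, hX']
  | tmul f u => rw [hat_tmul, map_smul, LinearMap.smul_apply, P.hat_mulActH ρ hN, hat_tmul]

end Twisted

theorem comul_tmul_eq_sum {I : Type*} {a : U} (s : Coalgebra.Repr k a I) (f : R) :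
    comul (R := R) (f ⊗ₜ[k] a) =
      ∑ i ∈ s.index, (f ⊗ₜ[k] s.left i) ⊗ₜ[R] ((1 : R) ⊗ₜ[k] s.right i) := by
  rw [TensorProduct.comul_tmul, ← s.eq, TensorProduct.tmul_sum, map_sum]
  refine Finset.sum_congr rfl fun i _ => ?_
  have h : f ⊗ₜ[k] s.right i = f • ((1 : R) ⊗ₜ[k] s.right i) := by
    rw [TensorProduct.smul_tmul', smul_eq_mul, mul_one]
  rw [CommSemiring.comul_apply, TensorProduct.AlgebraTensorModule.tensorTensorTensorComm_tmul, h,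
    TensorProduct.tmul_smul, TensorProduct.smul_tmul', TensorProduct.smul_tmul', smul_eq_mul,
    mul_one]

theorem comul_tmul_oudomGuin {I : Type*} {u : Us} (s : Coalgebra.Repr k u I) (f : R) :
    comul (R := R) (f ⊗ₜ[k] P.oudomGuin u) = ∑ i ∈ s.index,
      (f ⊗ₜ[k] P.oudomGuin (s.left i)) ⊗ₜ[R] ((1 : R) ⊗ₜ[k] P.oudomGuin (s.right i)) :=
  comul_tmul_eq_sum (s.induced P.oudomGuinCoalgEquiv) f

theorem counit_tmul' (f : R) (a : U) :
    counit (R := R) (f ⊗ₜ[k] a) = counit (R := k) a • f := by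
  rw [TensorProduct.counit_tmul]
  rfl

/-- An `R`-linear identity in Sweedler notation on `R ⊗ U(g)` holds if it holds on `U(g)`. -/
theorem eq_sum_repr {N : Type*} [AddCommGroup N] [Module R N] (F : H →ₗ[R] N)
    (B : H →ₗ[R] H →ₗ[R] N)
    (h : ∀ (u : Us) (s : Sweedler k u), F (1 ⊗ₜ P.oudomGuin u) = ∑ i ∈ s.index,
      B (1 ⊗ₜ P.oudomGuin (s.left i)) (1 ⊗ₜ P.oudomGuin (s.right i)))
    {I : Type*} {X : H} (s : Coalgebra.Repr R X I) :
    F X = ∑ i ∈ s.index, B (s.left i) (s.right i) := by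
  have e : ∑ i ∈ s.index, B (s.left i) (s.right i) = TensorProduct.lift B (comul (R := R) X) := by
    rw [← s.eq, map_sum]
    rfl
  rw [e]
  clear e s
  induction X using P.tensor_induction with
  | add X Y hX hY => simp only [map_add, hX, hY]
  | tmul f u =>
    obtain ⟨s⟩ := Sweedler.nonempty (R := k) u
    have hf : ∀ a : U, f ⊗ₜ[k] a = f • ((1 : R) ⊗ₜ[k] a) := fun a => by
      rw [TensorProduct.smul_tmul', smul_eq_mul, mul_one]
    rw [hf, map_smul, map_smul, map_smul, h u s, P.comul_tmul_oudomGuin s, map_sum]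
    rfl

/-- The coproduct over `R` can be written with all coefficients in the left factor and `1` in the
right one (the map `κ`). As `ρ(x)` kills `1`, the diagonal operator of `x` differentiates the
coefficient once and otherwise acts as the coderivation `d x`. -/
theorem comul_tensorAct (d : P.SubAdjacent →ₗ⁅k⁆ Module.End k U)
    (hd : ∀ x a, comul (R := k) (d x a) =
      (d x).rTensor U (comul (R := k) a) + (d x).lTensor U (comul (R := k) a))
    (u : Us) (Z : H) : comul (R := R) (P.tensorAct ρ d u Z) =
      P.tensorSquare ρ (P.tensorAct ρ d) (P.isTwisted_tensorAct ρ d) u (comul (R := R) Z) := by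
  let κ (f : R) : U ⊗[k] U →ₗ[k] H ⊗[R] H := TensorProduct.lift
    (LinearMap.mk₂ k (fun a b => (f ⊗ₜ[k] a) ⊗ₜ[R] ((1 : R) ⊗ₜ[k] b))
      (fun _ _ _ => by rw [TensorProduct.tmul_add, TensorProduct.add_tmul])
      (fun _ _ _ => by rw [TensorProduct.tmul_smul]; rfl)
      (fun _ _ _ => by rw [TensorProduct.tmul_add, TensorProduct.tmul_add])
      (fun _ _ _ => by rw [TensorProduct.tmul_smul, TensorProduct.tmul_smul]))
  have hκ : ∀ f a b, κ f (a ⊗ₜ b) = (f ⊗ₜ[k] a) ⊗ₜ[R] ((1 : R) ⊗ₜ[k] b) := fun _ _ _ => rfl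
  have hΔ : ∀ f a, comul (R := R) (f ⊗ₜ[k] a) = κ f (comul (R := k) a) := by
    intro f a
    obtain ⟨s⟩ := Sweedler.nonempty (R := k) a
    rw [comul_tmul_eq_sum s, ← s.eq, map_sum]
    rfl
  have key : ∀ x f z, P.tensorSquare ρ (P.tensorAct ρ d) (P.isTwisted_tensorAct ρ d) (ι k x)
      (κ f z) = κ (ρ x f) z + κ f ((d x).rTensor U z + (d x).lTensor U z) := by
    intro x f z
    induction z with
    | zero => simp
    | add z w hz hw => simp only [map_add, hz, hw]; abel
    | tmul a b =>
      simp only [hκ, tensorSquare_ι, tensorSquareLin_tmul, tensorAct_ι_tmul, map_add,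
        LinearMap.rTensor_tmul, LinearMap.lTensor_tmul, Derivation.map_one_eq_zero,
        TensorProduct.zero_tmul, TensorProduct.add_tmul, zero_add]
      abel
  induction u using word_induction generalizing Z with
  | scalar r =>
    rw [AlgHom.commutes, AlgHom.commutes, Module.algebraMap_end_apply,
      Module.algebraMap_end_apply, ← algebraMap_smul R, map_smul, algebraMap_smul]
  | add u w hu hw => simp only [map_add, LinearMap.add_apply, hu, hw]
  | mul x u hu =>
    rw [map_mul, Module.End.mul_apply, map_mul, Module.End.mul_apply, ← hu]
    generalize P.tensorAct ρ d u Z = Y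
    induction Y with
    | zero => simp
    | add X Y hX hY => simp only [map_add, hX, hY]
    | tmul f a => rw [tensorAct_ι_tmul, map_add, hΔ, hΔ, hΔ, key, hd, map_add]

theorem counit_tensorAct (d : P.SubAdjacent →ₗ⁅k⁆ Module.End k U)
    (hd : ∀ x a, counit (R := k) (d x a) = 0) (u : Us) (Z : H) :
    counit (R := R) (P.tensorAct ρ d u Z) = liftDer P ρ u (counit (R := R) Z) := by
  induction u using word_induction generalizing Z with
  | scalar r =>
    rw [AlgHom.commutes, AlgHom.commutes, Module.algebraMap_end_apply,
      Module.algebraMap_end_apply, ← algebraMap_smul R, map_smul, algebraMap_smul]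
  | add u w hu hw => simp only [map_add, LinearMap.add_apply, hu, hw]
  | mul x u hu =>
    rw [map_mul, Module.End.mul_apply, map_mul, Module.End.mul_apply, ← hu]
    generalize P.tensorAct ρ d u Z = Y
    induction Y with
    | zero => simp
    | add X Y hX hY => simp only [map_add, hX, hY]
    | tmul f a =>
      rw [tensorAct_ι_tmul, map_add, counit_tmul', counit_tmul', counit_tmul', hd, zero_smul,
        add_zero, liftDer_ι, Derivation.map_smul]

theorem comul_actH (u : Us) (Z : H) : comul (R := R) (P.actH ρ u Z) =
    P.tensorSquare ρ (P.actH ρ) (P.isTwisted_actH ρ) u (comul (R := R) Z) :=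
  P.comul_tensorAct ρ P.der P.comul_derLin u Z

theorem counit_actH (u : Us) (Z : H) :
    counit (R := R) (P.actH ρ u Z) = liftDer P ρ u (counit (R := R) Z) :=
  P.counit_tensorAct ρ P.der P.counit_derLin u Z

theorem comul_mulActH (u : Us) (Z : H) : comul (R := R) (P.mulActH ρ u Z) =
    P.tensorSquare ρ (P.mulActH ρ) (P.isTwisted_mulActH ρ) u (comul (R := R) Z) := by
  refine P.comul_tensorAct ρ P.mulDer (fun x a => ?_) u Z
  show comul (ι k (P.ofSub x) * a + P.derLin x a) =
    (LinearMap.mulLeft k (ι k (P.ofSub x)) + P.derLin x).rTensor U (comul (R := k) a) +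
    (LinearMap.mulLeft k (ι k (P.ofSub x)) + P.derLin x).lTensor U (comul (R := k) a)
  rw [map_add, comul_derLin, UniversalEnvelopingAlgebra.comul_ι_mul]
  generalize comul (R := k) a = z
  induction z with
  | zero => simp
  | add z w hz hw =>
    simp only [mul_add _ z w, map_add _ z w]
    have h := congrArg₂ (· + ·) hz hw
    beta_reduce at h
    exact Eq.trans (by abel) (h.trans (by abel))
  | tmul b c =>
    simp only [add_mul, Algebra.TensorProduct.tmul_mul_tmul, one_mul, LinearMap.rTensor_tmul,
      LinearMap.lTensor_tmul, LinearMap.add_apply, LinearMap.mulLeft_apply,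
      TensorProduct.add_tmul, TensorProduct.tmul_add]
    abel

theorem counit_mulActH (u : Us) (Z : H) :
    counit (R := R) (P.mulActH ρ u Z) = liftDer P ρ u (counit (R := R) Z) := by
  refine P.counit_tensorAct ρ P.mulDer (fun x a => ?_) u Z
  show counit (ι k (P.ofSub x) * a + P.derLin x a) = 0
  rw [map_add, counit_derLin, UniversalEnvelopingAlgebra.counit_ι_mul, add_zero]

theorem actH_mul {I : Type*} {u : Us} (s : Coalgebra.Repr k u I) (X Y : H) :
    P.actH ρ u (X * Y) =
      ∑ i ∈ s.index, P.actH ρ (s.left i) X * P.actH ρ (s.right i) Y := by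
  refine UniversalEnvelopingAlgebra.map_bilin_eq_sum (LinearMap.mul k H) (fun x X Y => ?_) s X Y
  simp only [LinearMap.mul_apply']
  induction X with
  | zero => simp
  | add X X' hX hX' => simp only [add_mul, map_add, hX, hX']; abel
  | tmul f a =>
    induction Y with
    | zero => simp
    | add Y Y' hY hY' => simp only [mul_add, map_add, hY, hY']; abel
    | tmul f' b =>
      simp only [Algebra.TensorProduct.tmul_mul_tmul, actH_ι_tmul, Derivation.leibniz, derLin_mul,
        add_mul, mul_add, TensorProduct.add_tmul, TensorProduct.tmul_add, smul_eq_mul]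
      rw [mul_comm f' (ρ x f)]
      abel

theorem mulActH_mul {I : Type*} {u : Us} (s : Coalgebra.Repr k u I) (X Y : H) :
    P.mulActH ρ u (X * Y) =
      ∑ i ∈ s.index, P.mulActH ρ (s.left i) X * P.actH ρ (s.right i) Y := by
  refine UniversalEnvelopingAlgebra.map_bilin_eq_sum (LinearMap.mul k H) (fun x X Y => ?_) s X Y
  simp only [LinearMap.mul_apply']
  induction X with
  | zero => simp
  | add X X' hX hX' => simp only [add_mul, map_add, hX, hX']; abel
  | tmul f a =>
    induction Y with
    | zero => simp
    | add Y Y' hY hY' => simp only [mul_add, map_add, hY, hY']; abel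
    | tmul f' b =>
      simp only [Algebra.TensorProduct.tmul_mul_tmul, actH_ι_tmul, mulActH_ι_tmul,
        Derivation.leibniz, derLin_mul, add_mul, mul_add, TensorProduct.add_tmul,
        TensorProduct.tmul_add, smul_eq_mul, mul_assoc]
      rw [mul_comm f' (ρ x f)]
      abel

end PostLieAlgebra

namespace PostLieAlgebra

variable {k R g : Type*} [CommRing k] [CommRing R] [Algebra k R] [LieRing g] [LieAlgebra k g]
  (P : PostLieAlgebra k g) (ρ : P.SubAdjacent →ₗ⁅k⁆ Derivation k R R)

local notation "U" => UniversalEnvelopingAlgebra k g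
local notation "Us" => UniversalEnvelopingAlgebra k P.SubAdjacent
local notation "H" => R ⊗[k] UniversalEnvelopingAlgebra k g

theorem tensor_eq_smul (f : R) (a : U) : f ⊗ₜ[k] a = f • ((1 : R) ⊗ₜ[k] a) := by
  rw [TensorProduct.smul_tmul', smul_eq_mul, mul_one]

theorem actH_one (u : Us) : P.actH ρ u (1 : H) = algebraMap k H (counit (R := k) u) := by
  induction u using word_induction with
  | scalar r =>
    rw [AlgHom.commutes, Module.algebraMap_end_apply,
      UniversalEnvelopingAlgebra.counit_algebraMap, Algebra.algebraMap_eq_smul_one]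
  | add u v hu hv => simp only [map_add, LinearMap.add_apply, hu, hv]
  | mul x u hu =>
    rw [map_mul, Module.End.mul_apply, hu, UniversalEnvelopingAlgebra.counit_ι_mul, map_zero,
      Algebra.algebraMap_eq_smul_one, map_smul, Algebra.TensorProduct.one_def, actH_ι_tmul,
      derLin_one, Derivation.map_one_eq_zero, TensorProduct.zero_tmul, TensorProduct.tmul_zero,
      add_zero, smul_zero]

theorem actH_tmul_one (u : Us) (f : R) :
    P.actH ρ u (f ⊗ₜ 1) = liftDer P ρ u f ⊗ₜ (1 : U) := by
  induction u using word_induction with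
  | scalar r =>
    rw [AlgHom.commutes, Module.algebraMap_end_apply, AlgHom.commutes,
      Module.algebraMap_end_apply, TensorProduct.smul_tmul']
  | add u v hu hv => simp only [map_add, LinearMap.add_apply, hu, hv, TensorProduct.add_tmul]
  | mul x u hu =>
    rw [map_mul, Module.End.mul_apply, hu, actH_ι_tmul, derLin_one, TensorProduct.tmul_zero,
      add_zero, map_mul, Module.End.mul_apply, liftDer_ι]

theorem counit_tmul_oudomGuin (f : R) (u : Us) :
    counit (R := R) (f ⊗ₜ[k] P.oudomGuin u) = counit (R := k) u • f := by
  rw [counit_tmul', counit_oudomGuin]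

/-- Writing `Y = 1 · Y` in the Leibniz rule for `mulActH` identifies `hat mulActH` with the
Grossman-Larson product of `hat actH`. This lets the axiom `tri_tri` be deduced from `hat_hat`. -/
theorem hat_mulActH_eq_sum {I : Type*} {X : H} (s : Coalgebra.Repr R X I) (Y : H) :
    P.hat (P.mulActH ρ) X Y =
      ∑ i ∈ s.index, s.left i * P.hat (P.actH ρ) (s.right i) Y := by
  refine P.eq_sum_repr (P.hatApply (P.mulActH ρ) Y)
    ((LinearMap.mul R H).compl₂ (P.hatApply (P.actH ρ) Y)) (fun u s => ?_) s
  rw [hatApply_apply, hat_tmul, one_smul, ← one_mul Y, P.mulActH_mul ρ s, one_mul]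
  refine Finset.sum_congr rfl fun i _ => ?_
  rw [LinearMap.compl₂_apply, LinearMap.mul_apply', hatApply_apply, hat_tmul, one_smul,
    Algebra.TensorProduct.one_def, ← oudomGuin_one, mulActH_one_tmul_oudomGuin, mul_one]

/-- The weak post-Hopf algebroid structure of `R ⊗ U(g)`. -/
def weakActionAlgebroid : WeakPostHopfAlgebroid k R H where
  cocomm := inferInstance
  antipode_mul := HopfAlgebra.antipode_mul_antidistrib
  antipode_bijective := by
    have h : Function.Involutive (antipode R : H →ₗ[R] H) := fun x => by
      induction x with
      | zero => simp
      | add x x' hx hx' => rw [map_add, map_add, hx, hx']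
      | tmul f a =>
        simp only [TensorProduct.antipode_def,
          TensorProduct.AlgebraTensorModule.map_tmul, UniversalEnvelopingAlgebra.antipode_antipode,
          CommSemiring.antipode_eq_id, LinearMap.id_apply]
    exact h.bijective
  tri := (P.hat (P.actH ρ)).restrictScalars k
  comul_tri x y sx sy := by
    -- With the decomposition of `y` outermost and fixed, each side is `R`-linear in `x` or in
    -- `Δ(x)`, and it suffices to take `x = 1 ⊗ Φ(u)`.
    rw [Finset.sum_comm]
    refine (P.eq_sum_repr (comul ∘ₗ P.hatApply (P.actH ρ) y)
      (∑ j ∈ sy.index, (TensorProduct.mk R H H).compl₁₂ (P.hatApply (P.actH ρ) (sy.left j))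
        (P.hatApply (P.actH ρ) (sy.right j))) (fun u s => ?_) sx).trans ?_
    · rw [LinearMap.comp_apply, hatApply_apply, hat_tmul, one_smul, comul_actH, ← sy.eq, map_sum]
      simp only [P.tensorSquare_tmul ρ _ _ s, LinearMap.sum_apply, LinearMap.compl₁₂_apply,
        hatApply_apply, hat_tmul, one_smul, TensorProduct.mk_apply]
      rw [Finset.sum_comm]
    · simp only [LinearMap.sum_apply]
      rw [Finset.sum_comm]
      rfl
  tri_one x := by
    show P.hat (P.actH ρ) x 1 = _
    induction x using P.tensor_induction with
    | add X Y hX hY => simp only [map_add, LinearMap.add_apply, hX, hY]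
    | tmul f u =>
      rw [hat_tmul, actH_one, counit_tmul_oudomGuin, Algebra.algebraMap_eq_smul_one,
        Algebra.algebraMap_eq_smul_one, smul_assoc, smul_comm]
  one_tri x := by
    show P.hat (P.actH ρ) 1 x = _
    rw [Algebra.TensorProduct.one_def, hat_tmul_one, one_smul]
  counit_tri x y := by
    show algebraMap R H (counit (P.hat (P.actH ρ) x y)) =
      P.hat (P.actH ρ) x (algebraMap R H (counit y))
    induction x using P.tensor_induction with
    | add X Y hX hY => simp only [map_add, LinearMap.add_apply, hX, hY]
    | tmul f u =>
      rw [hat_tmul, hat_tmul, map_smul, counit_actH, Algebra.TensorProduct.algebraMap_apply,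
        Algebra.TensorProduct.algebraMap_apply, Algebra.algebraMap_self_apply,
        Algebra.algebraMap_self_apply, actH_tmul_one, TensorProduct.smul_tmul']
  smul_tri f x y := by
    show P.hat (P.actH ρ) (f • x) y = f • P.hat (P.actH ρ) x y
    rw [map_smul, LinearMap.smul_apply]
  tri_mul x y z s := by
    refine P.eq_sum_repr (P.hatApply (P.actH ρ) (y * z))
      ((LinearMap.mul R H).compl₁₂ (P.hatApply (P.actH ρ) y) (P.hatApply (P.actH ρ) z))
      (fun u s => ?_) s
    rw [hatApply_apply, hat_tmul, one_smul, P.actH_mul ρ s]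
    simp only [LinearMap.compl₁₂_apply, hatApply_apply, hat_tmul, one_smul, LinearMap.mul_apply']
  tri_tri x y z s := by
    show P.hat (P.actH ρ) x (P.hat (P.actH ρ) y z) =
      P.hat (P.actH ρ) (∑ i ∈ s.index, s.left i * P.hat (P.actH ρ) (s.right i) y) z
    rw [← hat_mulActH_eq_sum, P.hat_hat ρ (P.isTwisted_actH ρ)]

theorem weakActionAlgebroid_glMul (X Y : H) :
    (P.weakActionAlgebroid ρ).glMul X Y = P.hat (P.mulActH ρ) X Y := by
  obtain ⟨s⟩ := Sweedler.nonempty (R := R) X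
  rw [WeakPostHopfAlgebroid.glMul_eq _ _ _ s, P.hat_mulActH_eq_sum ρ s]
  rfl

/-! ### The anti-automorphism -/

/-- The map `θ` with `θ(f ⊗ Φ(u)) = S(u) * f`. -/
def theta : H →ₗ[k] H := TensorProduct.lift
  ((((P.mulActH ρ).toLinearMap ∘ₗ antipode k ∘ₗ
    P.oudomGuinCoalgEquiv.symm.toLinearEquiv.toLinearMap).flip ∘ₗ
      (TensorProduct.mk k R U).flip 1))

theorem theta_tmul_oudomGuin (f : R) (u : Us) :
    P.theta ρ (f ⊗ₜ P.oudomGuin u) = P.mulActH ρ (antipode k u) (f ⊗ₜ 1) :=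
  congrArg (fun v => P.mulActH ρ (antipode k v) (f ⊗ₜ 1)) (P.symm_oudomGuin u)

theorem theta_tmul_one (f : R) : P.theta ρ (f ⊗ₜ 1) = f ⊗ₜ 1 := by
  rw [← oudomGuin_one, theta_tmul_oudomGuin, HopfAlgebra.antipode_one, map_one,
    Module.End.one_apply, oudomGuin_one]

/-- Scalar multiplication by `f` is the product `f * Y`, so this is the anti-multiplicativity of `θ`
for a left factor in `R`. It rests on `S(v) * (f f') = (S(v) * f') * f`. -/
theorem theta_smul (f : R) (Y : H) :
    P.theta ρ (f • Y) = P.hat (P.mulActH ρ) (P.theta ρ Y) (f ⊗ₜ 1) := by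
  induction Y using P.tensor_induction with
  | add X Y hX hY => simp only [smul_add, map_add, LinearMap.add_apply, hX, hY]
  | tmul f' v =>
    rw [TensorProduct.smul_tmul', theta_tmul_oudomGuin, theta_tmul_oudomGuin,
      P.hat_mulActH ρ (P.isTwisted_mulActH ρ), hat_tmul_one, TensorProduct.smul_tmul',
      smul_eq_mul, smul_eq_mul, mul_comm]

theorem theta_mulActH (u : Us) (Y : H) : P.theta ρ (P.mulActH ρ u Y) =
    P.hat (P.mulActH ρ) (P.theta ρ Y) (1 ⊗ₜ P.oudomGuin (antipode k u)) := by
  induction u using word_induction with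
  | scalar r =>
    rw [AlgHom.commutes, Module.algebraMap_end_apply, map_smul,
      UniversalEnvelopingAlgebra.antipode_algebraMap, oudomGuin_algebraMap,
      Algebra.algebraMap_eq_smul_one, TensorProduct.tmul_smul, map_smul]
    congr 1
    have := P.theta_smul ρ (1 : R) Y
    rwa [one_smul] at this
  | add u v hu hv =>
    simp only [map_add, LinearMap.add_apply, hu, hv, TensorProduct.tmul_add]
  | mul x u hu =>
    -- On `Z = f Φ(v)` the product `x * Z` is `ρ(x)(f) Φ(v) + f Φ(xv)`. Under `θ` the second term
    -- becomes `-S(v) * (x * f)`, and the part of it with `ρ(x)(f)` cancels the first term.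
    have key : ∀ Z : H, P.theta ρ (P.mulActH ρ (ι k x) Z) =
        -P.hat (P.mulActH ρ) (P.theta ρ Z) (1 ⊗ₜ P.oudomGuin (ι k x)) := by
      intro Z
      induction Z using P.tensor_induction with
      | add X Y hX hY => simp only [map_add, LinearMap.add_apply, hX, hY, neg_add]
      | tmul f v =>
        rw [mulActH_ι_tmul_oudomGuin, map_add, theta_tmul_oudomGuin, theta_tmul_oudomGuin,
          theta_tmul_oudomGuin, P.hat_mulActH ρ (P.isTwisted_mulActH ρ), hat_tmul_one,
          TensorProduct.smul_tmul', smul_eq_mul, mul_one,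
          UniversalEnvelopingAlgebra.antipode_ι_mul, map_neg, LinearMap.neg_apply, map_mul,
          Module.End.mul_apply, ← oudomGuin_one, mulActH_ι_tmul_oudomGuin, mul_one, map_add,
          neg_add, add_neg_cancel_left]
    rw [map_mul, Module.End.mul_apply, key, hu, P.hat_hat ρ (P.isTwisted_mulActH ρ), hat_tmul,
      one_smul, mulActH_one_tmul_oudomGuin, UniversalEnvelopingAlgebra.antipode_ι_mul, map_neg,
      TensorProduct.tmul_neg, map_neg]

/-- Since `f ⊗ Φ(u) = f * Φ(u)`, left factors from `R` and from `U(g_▷)` suffice. -/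
theorem theta_hat (X Y : H) : P.theta ρ (P.hat (P.mulActH ρ) X Y) =
    P.hat (P.mulActH ρ) (P.theta ρ Y) (P.theta ρ X) := by
  induction X using P.tensor_induction with
  | add X X' hX hX' => simp only [map_add, LinearMap.add_apply, hX, hX']
  | tmul f u =>
    rw [hat_tmul, theta_smul, theta_mulActH, P.hat_hat ρ (P.isTwisted_mulActH ρ), hat_tmul,
      one_smul, theta_tmul_oudomGuin]

theorem theta_theta (X : H) : P.theta ρ (P.theta ρ X) = X := by
  induction X using P.tensor_induction with
  | add X Y hX hY => rw [map_add, map_add, hX, hY]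
  | tmul f u =>
    rw [theta_tmul_oudomGuin, theta_mulActH, UniversalEnvelopingAlgebra.antipode_antipode,
      theta_tmul_one, hat_tmul_one, ← tensor_eq_smul]

/-- The decomposition of `Δ(S(u))` that is induced by one of `Δ(u)`. -/
def reprAntipode {I : Type*} {u : Us} (s : Coalgebra.Repr k u I) :
    Coalgebra.Repr k (antipode k u) I where
  index := s.index
  left i := antipode k (s.left i)
  right i := antipode k (s.right i)
  eq := by
    show _ = comul _
    rw [UniversalEnvelopingAlgebra.comul_antipode, ← s.eq, map_sum]
    rfl

/-- The section `(f ⊗ a) ⊗_R (1 ⊗ b) ↦ (f ⊗ a) ⊗_k (1 ⊗ b)`. -/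
def tensorSection : H ⊗[R] H →ₗ[R] H ⊗[k] H :=
  TensorProduct.lift
    { toFun := fun X => LinearMap.liftBaseChange R
        (TensorProduct.mk k H H X ∘ₗ TensorProduct.mk k R U 1)
      map_add' := fun X Y => by
        refine TensorProduct.AlgebraTensorModule.ext fun f a => ?_
        simp
      map_smul' := fun r X => by
        refine TensorProduct.AlgebraTensorModule.ext fun f a => ?_
        simp [TensorProduct.smul_tmul', smul_comm f r] }

theorem tensorSection_tmul (X : H) (f : R) (a : U) :
    tensorSection (X ⊗ₜ[R] (f ⊗ₜ[k] a)) = f • (X ⊗ₜ[k] ((1 : R) ⊗ₜ[k] a)) := by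
  simp [tensorSection]

theorem tensorSection_comul (f : R) {I : Type*} {u : Us} (s : Coalgebra.Repr k u I) :
    tensorSection (comul (R := R) (f ⊗ₜ[k] P.oudomGuin u)) = ∑ i ∈ s.index,
      (f ⊗ₜ[k] P.oudomGuin (s.left i)) ⊗ₜ[k] ((1 : R) ⊗ₜ[k] P.oudomGuin (s.right i)) := by
  rw [P.comul_tmul_oudomGuin s, map_sum]
  exact Finset.sum_congr rfl fun i _ => by rw [tensorSection_tmul, one_smul]

theorem counit_theta_tmul (f : R) (u : Us) :
    counit (R := R) (P.theta ρ (f ⊗ₜ P.oudomGuin u)) = liftDer P ρ (antipode k u) f := by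
  rw [theta_tmul_oudomGuin, counit_mulActH, counit_tmul', Bialgebra.counit_one, one_smul]

theorem theta_hat_self (f : R) {I : Type*} {u : Us} (s : Coalgebra.Repr k u I) :
    ∑ i ∈ s.index, P.hat (P.mulActH ρ) (P.theta ρ (f ⊗ₜ P.oudomGuin (s.left i)))
      (1 ⊗ₜ P.oudomGuin (s.right i)) = liftDer P ρ (antipode k u) f ⊗ₜ 1 := by
  -- `f` is kept variable because removing a generator `x` trades `f` for `-ρ(x)(f)`; the terms with
  -- `Φ(xq)` cancel.
  let F (f : R) : Us ⊗[k] Us →ₗ[k] H := TensorProduct.lift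
    (((P.mulActH ρ).toLinearMap ∘ₗ antipode k).compl₂ (TensorProduct.mk k R U f ∘ₗ P.oudomGuin))
  have hF : ∀ f p q, F f (p ⊗ₜ q) = P.mulActH ρ (antipode k p) (f ⊗ₜ P.oudomGuin q) :=
    fun _ _ _ => rfl
  have key : ∀ (x : P.SubAdjacent) f z,
      F f ((ι k x ⊗ₜ[k] 1 + 1 ⊗ₜ[k] ι k x) * z) = -F (ρ x f) z := by
    intro x f z
    induction z with
    | zero => simp
    | add z w hz hw => rw [mul_add, map_add, hz, hw, map_add, neg_add]
    | tmul p q =>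
      rw [add_mul, Algebra.TensorProduct.tmul_mul_tmul, Algebra.TensorProduct.tmul_mul_tmul,
        one_mul, one_mul, map_add, hF, hF, hF, UniversalEnvelopingAlgebra.antipode_ι_mul, map_neg,
        LinearMap.neg_apply, map_mul, Module.End.mul_apply, mulActH_ι_tmul_oudomGuin, map_add,
        neg_add, neg_add_cancel_right]
  have main : ∀ u f, F f (comul (R := k) u) = liftDer P ρ (antipode k u) f ⊗ₜ 1 := by
    intro u
    induction u using word_induction with
    | scalar r =>
      intro f
      rw [UniversalEnvelopingAlgebra.comul_algebraMap, hF, oudomGuin_one,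
        UniversalEnvelopingAlgebra.antipode_algebraMap, AlgHom.commutes, AlgHom.commutes,
        Module.algebraMap_end_apply, Module.algebraMap_end_apply, TensorProduct.smul_tmul']
    | add a b ha hb =>
      intro f; simp only [map_add, LinearMap.add_apply, ha, hb, TensorProduct.add_tmul]
    | mul x a ha =>
      intro f
      rw [UniversalEnvelopingAlgebra.comul_ι_mul, key, ha,
        UniversalEnvelopingAlgebra.antipode_ι_mul, map_neg, map_mul, LinearMap.neg_apply,
        Module.End.mul_apply, liftDer_ι, TensorProduct.neg_tmul]
  rw [← main, ← s.eq, map_sum]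
  refine Finset.sum_congr rfl fun i _ => ?_
  rw [theta_tmul_oudomGuin, P.hat_mulActH ρ (P.isTwisted_mulActH ρ), hat_tmul_one,
    ← tensor_eq_smul, hF]

/-- The action post-Hopf algebroid `R ⊗ U(g)`. -/
def actionAlgebroid : PostHopfAlgebroid k R H where
  toWeakPostHopfAlgebroid := P.weakActionAlgebroid ρ
  theta := LinearEquiv.ofInvolutive (P.theta ρ) (P.theta_theta ρ)
  theta_glMul x y := by
    simp only [weakActionAlgebroid_glMul]
    exact P.theta_hat ρ x y
  theta_algebraMap f := P.theta_tmul_one ρ f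
  exists_section := by
    refine ⟨tensorSection.restrictScalars k, fun t => ?_, fun x => ?_, fun x => ?_⟩
    · show TensorProduct.mapOfCompatibleSMul R k k H H (tensorSection t) = t
      induction t with
      | zero => simp
      | add t t' h h' => rw [map_add, map_add, h, h']
      | tmul X Y =>
        induction Y with
        | zero => simp
        | add Y Y' h h' => rw [TensorProduct.tmul_add, map_add, map_add, h, h']
        | tmul f a =>
          rw [tensorSection_tmul, tensor_eq_smul f a, TensorProduct.tmul_smul,
            TensorProduct.smul_tmul', TensorProduct.smul_tmul',
            TensorProduct.mapOfCompatibleSMul_tmul]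
    · show comul (P.theta ρ x) = TensorProduct.mapOfCompatibleSMul R k k H H
        (TensorProduct.map (P.theta ρ) (P.theta ρ) (tensorSection (comul x)))
      induction x using P.tensor_induction with
      | add X Y hX hY => simp only [map_add, hX, hY]
      | tmul f u =>
        obtain ⟨s⟩ := Sweedler.nonempty (R := k) u
        rw [P.tensorSection_comul f s, theta_tmul_oudomGuin, comul_mulActH, map_sum, map_sum]
        have h : comul (R := R) (f ⊗ₜ[k] (1 : U)) = (f ⊗ₜ[k] 1) ⊗ₜ[R] ((1 : R) ⊗ₜ[k] 1) :=
          (comul_tmul_eq_sum (⟨{0}, fun _ => 1, fun _ => 1, by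
            rw [Finset.sum_singleton, Bialgebra.comul_one, Algebra.TensorProduct.one_def]⟩ :
            Sweedler k (1 : U)) f).trans (Finset.sum_singleton _ _)
        rw [h, P.tensorSquare_tmul ρ _ _ (P.reprAntipode s)]
        refine Finset.sum_congr rfl fun i _ => ?_
        rw [TensorProduct.map_tmul, TensorProduct.mapOfCompatibleSMul_tmul, theta_tmul_oudomGuin,
          theta_tmul_oudomGuin]
        rfl
    · show TensorProduct.lift ((P.weakActionAlgebroid ρ).glMul.compl₂ (P.theta ρ))
        (tensorSection (comul x)) = _
      induction x using P.tensor_induction with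
      | add X Y hX hY => simp only [map_add, hX, hY]
      | tmul f u =>
        obtain ⟨s⟩ := Sweedler.nonempty (R := k) u
        rw [P.tensorSection_comul f s, map_sum, counit_tmul_oudomGuin]
        -- As the section puts the coefficient `f` on the left, `θ` meets only elements `1 ⊗ Φ(u₂)`,
        -- and the identity is `f` times the antipode axiom of `U(g_▷)` applied to `1`.
        have h := congrArg (fun v => f • P.mulActH ρ v ((1 : R) ⊗ₜ 1))
          (HopfAlgebra.sum_mul_antipode_eq_algebraMap_counit s)
        beta_reduce at h
        rw [AlgHom.commutes, Module.algebraMap_end_apply, smul_comm, TensorProduct.smul_tmul',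
          TensorProduct.smul_tmul', smul_eq_mul, mul_one, map_sum, LinearMap.sum_apply,
          Finset.smul_sum] at h
        refine Eq.trans (Finset.sum_congr rfl fun i _ => ?_) h
        rw [TensorProduct.lift.tmul, LinearMap.compl₂_apply, weakActionAlgebroid_glMul, hat_tmul,
          theta_tmul_oudomGuin, map_mul, Module.End.mul_apply]
  theta_glMul_self x s := by
    -- No section is needed on this side: `θ(rX) * Y = (θ(X) * r) * Y = θ(X) * (rY)`, so the
    -- expression is balanced over `R`.
    let G : H ⊗[R] H →+ H := TensorProduct.liftAddHom
      (AddMonoidHom.mk' (fun X => AddMonoidHom.mk'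
        (fun Y => P.hat (P.mulActH ρ) (P.theta ρ X) Y) (fun Y Y' => map_add _ _ _))
        (fun X X' => by ext Y; simp))
      (fun r X Y => by
        simp only [AddMonoidHom.mk'_apply]
        rw [theta_smul, P.hat_hat ρ (P.isTwisted_mulActH ρ), hat_tmul_one])
    have hG : ∀ X Y, G (X ⊗ₜ Y) = P.hat (P.mulActH ρ) (P.theta ρ X) Y := fun _ _ => rfl
    have h : ∀ x, G (comul (R := R) x) = algebraMap R H (counit (R := R) (P.theta ρ x)) := by
      intro x
      induction x using P.tensor_induction with
      | add X Y hX hY => simp only [map_add, hX, hY]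
      | tmul f u =>
        obtain ⟨s⟩ := Sweedler.nonempty (R := k) u
        rw [P.comul_tmul_oudomGuin s, map_sum, counit_theta_tmul]
        exact P.theta_hat_self ρ f s
    refine Eq.trans ?_ (h x)
    rw [← s.eq, map_sum]
    exact Finset.sum_congr rfl fun i _ => P.weakActionAlgebroid_glMul ρ _ _

theorem isAction_actionAlgebroid :
    (P.actionAlgebroid ρ).IsAction P.postHopfAlgebra (P.oudomGuinIso.act ρ) where
  tri_tmul f f' a b s := by
    have h := congrArg (f • ·) (P.tensorAct_tmul ρ P.der (s.induced P.oudomGuinCoalgEquiv.symm) f' b)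
    beta_reduce at h
    rw [Finset.smul_sum] at h
    exact h
  theta_tmul f a s := by
    refine (P.tensorAct_tmul ρ P.mulDer
      (P.reprAntipode (s.induced P.oudomGuinCoalgEquiv.symm)) f 1).trans
      (Finset.sum_congr rfl fun i _ => ?_)
    rw [← P.oudomGuin_symm (s.left i), ← P.oudomGuin_symm (s.right i), subAntipode_oudomGuin,
      subAntipode_oudomGuin, oudomGuinIso_act]
    rfl

end PostLieAlgebra

/-! ### Transport of post-Hopf algebroids -/

/-- Composing `e` with either antipode gives a convolution inverse of `e`, one a left and the other
a right inverse, so they agree. -/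
theorem BialgEquiv.map_antipode {R H H' : Type*} [CommRing R] [Ring H] [HopfAlgebra R H] [Ring H']
    [HopfAlgebra R H'] (e : H ≃ₐc[R] H') (x : H) : e (antipode R x) = antipode R (e x) := by
  let f : H →ₗ[R] H' := (e : H →ₗc[R] H')
  have h : WithConv.toConv (antipode R ∘ₗ f) = WithConv.toConv (f ∘ₗ antipode R) := by
    apply left_inv_eq_right_inv (a := WithConv.toConv f)
    · ext x
      let s := Coalgebra.Repr.arbitrary R x
      have h := HopfAlgebra.sum_antipode_mul_eq_algebraMap_counit (s.induced e)
      rw [CoalgHomClass.counit_comp_apply] at h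
      rw [s.convMul_apply]
      exact h
    · ext x
      let s := Coalgebra.Repr.arbitrary R x
      have h := congrArg e (HopfAlgebra.sum_mul_antipode_eq_algebraMap_counit s)
      rw [AlgHomClass.commutes, map_sum] at h
      rw [s.convMul_apply]
      refine Eq.trans (Finset.sum_congr rfl fun i _ => ?_) h
      exact (map_mul e _ _).symm
  exact LinearMap.congr_fun (WithConv.toConv_injective h.symm) x

section Transport

variable {k R H H' : Type*} [CommRing k] [CommRing R] [Algebra k R]
  [Ring H] [Algebra k H] [HopfAlgebra R H] [IsScalarTower k R H]
  [Ring H'] [Algebra k H'] [HopfAlgebra R H'] [IsScalarTower k R H']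

variable (k) in
/-- An isomorphism of `R`-bialgebras as a `k`-linear equivalence. -/
def BialgEquiv.toLinearEquivOver (e : H ≃ₐc[R] H') : H ≃ₗ[k] H' :=
  (e.toCoalgEquiv.toLinearEquiv).restrictScalars k

theorem BialgEquiv.comul_apply (e : H ≃ₐc[R] H') (x : H) : comul (R := R) (e x) =
    TensorProduct.map (e.toLinearEquivOver R).toLinearMap (e.toLinearEquivOver R).toLinearMap
      (comul (R := R) x) :=
  (CoalgHomClass.map_comp_comul_apply e x).symm

theorem BialgEquiv.isCocomm (e : H ≃ₐc[R] H') (h : Coalgebra.IsCocomm R H) :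
    Coalgebra.IsCocomm R H' where
  comm_comp_comul := by
    ext x
    obtain ⟨x, rfl⟩ := e.surjective x
    show TensorProduct.comm R H' H' (comul (e x)) = comul (e x)
    rw [e.comul_apply, ← TensorProduct.map_comm, Coalgebra.comm_comul]

namespace WeakPostHopfAlgebroid

variable (W : WeakPostHopfAlgebroid k R H) (e : H ≃ₐc[R] H')

/-- Transport of a weak post-Hopf algebroid along an isomorphism of bialgebras. -/
def transport : WeakPostHopfAlgebroid k R H' where
  cocomm := e.isCocomm W.cocomm
  antipode_mul := HopfAlgebra.antipode_mul_antidistrib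
  antipode_bijective := by
    have h : (antipode R : H' → H') = e ∘ (antipode R : H → H) ∘ e.symm := by
      ext x
      rw [Function.comp_apply, Function.comp_apply, e.map_antipode, e.apply_symm_apply]
    rw [h]
    exact e.bijective.comp (W.antipode_bijective.comp e.symm.bijective)
  tri := (W.tri.compl₁₂ (e.toLinearEquivOver k).symm.toLinearMap
    (e.toLinearEquivOver k).symm.toLinearMap).compr₂ (e.toLinearEquivOver k).toLinearMap
  comul_tri x y sx sy := by
    show comul (e (W.tri (e.symm x) (e.symm y))) = _
    rw [e.comul_apply, W.comul_tri _ _ (sx.induced e.symm) (sy.induced e.symm), map_sum]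
    simp only [map_sum]
    rfl
  tri_one x := by
    show e (W.tri (e.symm x) (e.symm 1)) = _
    rw [map_one, W.tri_one, AlgHomClass.commutes, CoalgHomClass.counit_comp_apply]
  one_tri x := by
    show e (W.tri (e.symm 1) (e.symm x)) = _
    rw [map_one, W.one_tri, e.apply_symm_apply]
  counit_tri x y := by
    show algebraMap R H' (counit (e (W.tri (e.symm x) (e.symm y)))) =
      e (W.tri (e.symm x) (e.symm (algebraMap R H' (counit y))))
    rw [AlgHomClass.commutes, CoalgHomClass.counit_comp_apply,
      ← CoalgHomClass.counit_comp_apply e.symm y, ← W.counit_tri, AlgHomClass.commutes]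
  smul_tri f x y := by
    show e (W.tri (e.symm (f • x)) (e.symm y)) = f • e (W.tri (e.symm x) (e.symm y))
    rw [map_smul, W.smul_tri, map_smul]
  tri_mul x y z s := by
    show e (W.tri (e.symm x) (e.symm (y * z))) = _
    rw [map_mul, W.tri_mul _ _ _ (s.induced e.symm), map_sum]
    simp only [map_mul]
    rfl
  tri_tri x y z s := by
    show e (W.tri (e.symm x) (e.symm (e (W.tri (e.symm y) (e.symm z))))) =
      e (W.tri (e.symm (∑ i ∈ s.index, s.left i *
        e (W.tri (e.symm (s.right i)) (e.symm y)))) (e.symm z))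
    rw [e.symm_apply_apply, W.tri_tri _ _ _ (s.induced e.symm), map_sum e.symm]
    congr 3
    refine Finset.sum_congr rfl fun i _ => ?_
    rw [map_mul, e.symm_apply_apply]
    rfl

theorem transport_tri (x y : H') :
    (W.transport e).tri x y = e (W.tri (e.symm x) (e.symm y)) := rfl

theorem transport_glMul (x y : H') :
    (W.transport e).glMul x y = e (W.glMul (e.symm x) (e.symm y)) := by
  obtain ⟨s⟩ := Sweedler.nonempty (R := R) x
  rw [glMul_eq _ _ _ s, glMul_eq _ _ _ (s.induced e.symm), map_sum]
  refine Finset.sum_congr rfl fun i _ => ?_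
  rw [map_mul, transport_tri]
  exact congrArg (· * _) (e.apply_symm_apply _).symm

end WeakPostHopfAlgebroid

namespace PostHopfAlgebroid

variable (W : PostHopfAlgebroid k R H) (e : H ≃ₐc[R] H')

theorem mapOfCompatibleSMul_map (e : H ≃ₐc[R] H') (t : H ⊗[k] H) :
    TensorProduct.mapOfCompatibleSMul R k k H' H' (TensorProduct.map
      (e.toLinearEquivOver k).toLinearMap (e.toLinearEquivOver k).toLinearMap t) =
    TensorProduct.map (e.toLinearEquivOver R).toLinearMap (e.toLinearEquivOver R).toLinearMap
      (TensorProduct.mapOfCompatibleSMul R k k H H t) := by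
  induction t with
  | zero => simp
  | add t t' h h' => simp only [map_add, h, h']
  | tmul x y => rfl

/-- Transport of a post-Hopf algebroid along an isomorphism of bialgebras. -/
def transport : PostHopfAlgebroid k R H' where
  toWeakPostHopfAlgebroid := W.toWeakPostHopfAlgebroid.transport e
  theta := (e.toLinearEquivOver k).symm ≪≫ₗ W.theta ≪≫ₗ e.toLinearEquivOver k
  theta_glMul x y := by
    simp only [WeakPostHopfAlgebroid.transport_glMul]
    show e (W.theta (e.symm (e _))) = e (W.glMul (e.symm (e (W.theta (e.symm y))))
      (e.symm (e (W.theta (e.symm x)))))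
    simp only [e.symm_apply_apply, W.theta_glMul]
  theta_algebraMap f := by
    show e (W.theta (e.symm (algebraMap R H' f))) = _
    rw [AlgHomClass.commutes, W.theta_algebraMap, AlgHomClass.commutes]
  exists_section := by
    obtain ⟨γ, h1, h2, h3⟩ := W.exists_section
    let E : H' ⊗[R] H' →ₗ[R] H ⊗[R] H := TensorProduct.map
      (e.symm.toLinearEquivOver R).toLinearMap (e.symm.toLinearEquivOver R).toLinearMap
    have hE : ∀ x, E (comul x) = comul (R := R) (e.symm x) := fun x =>
      (e.symm.comul_apply x).symm
    refine ⟨TensorProduct.map (e.toLinearEquivOver k).toLinearMap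
      (e.toLinearEquivOver k).toLinearMap ∘ₗ γ ∘ₗ E.restrictScalars k, fun t => ?_, fun x => ?_,
      fun x => ?_⟩
    · show TensorProduct.mapOfCompatibleSMul R k k H' H' (TensorProduct.map _ _ (γ (E t))) = t
      rw [mapOfCompatibleSMul_map, h1]
      induction t with
      | zero => simp
      | add t t' h h' => simp only [map_add, h, h']
      | tmul x y => exact congrArg₂ (· ⊗ₜ[R] ·) (e.apply_symm_apply x) (e.apply_symm_apply y)
    · show comul (e (W.theta (e.symm x))) = TensorProduct.mapOfCompatibleSMul R k k H' H'
        (TensorProduct.map _ _ (TensorProduct.map _ _ (γ (E (comul x)))))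
      rw [hE, e.comul_apply, h2, ← mapOfCompatibleSMul_map, TensorProduct.map_map,
        TensorProduct.map_map]
      have h : (e.toLinearEquivOver k).toLinearMap ∘ₗ W.theta.toLinearMap =
          ((e.toLinearEquivOver k).symm ≪≫ₗ W.theta ≪≫ₗ e.toLinearEquivOver k).toLinearMap ∘ₗ
            (e.toLinearEquivOver k).toLinearMap := LinearMap.ext fun y => by
        show e (W.theta y) = e (W.theta (e.symm (e y)))
        rw [e.symm_apply_apply]
      rw [h]
    · show TensorProduct.lift _ (TensorProduct.map _ _ (γ (E (comul x)))) = _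
      rw [hE, ← CoalgHomClass.counit_comp_apply e.symm x, ← AlgHomClass.commutes e, ← h3]
      generalize γ (comul (e.symm x)) = t
      induction t with
      | zero => simp
      | add t t' h h' => simp only [map_add, h, h']
      | tmul y z =>
        refine (WeakPostHopfAlgebroid.transport_glMul _ e _ _).trans ?_
        show e (W.glMul (e.symm (e y)) (e.symm (e (W.theta (e.symm (e z)))))) =
          e (W.glMul y (W.theta z))
        simp only [e.symm_apply_apply]
  theta_glMul_self x s := by
    have h := congrArg e (W.theta_glMul_self (e.symm x) (s.induced e.symm))
    rw [map_sum, AlgHomClass.commutes] at h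
    refine Eq.trans (Finset.sum_congr rfl fun i _ => ?_)
      (h.trans (congrArg (algebraMap R H') (CoalgHomClass.counit_comp_apply e _).symm))
    rw [WeakPostHopfAlgebroid.transport_glMul]
    show e (W.glMul (e.symm (e (W.theta (e.symm (s.left i))))) _) = _
    rw [e.symm_apply_apply]
    rfl

/-- The isomorphism along which a post-Hopf algebroid is transported. -/
def isoTransport : W.Iso (W.transport e) where
  equiv := e
  map_antipode := e.map_antipode
  map_tri x y := by
    show _ = e (W.tri (e.symm (e x)) (e.symm (e y)))
    rw [e.symm_apply_apply, e.symm_apply_apply]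
  map_theta x := by
    show _ = e (W.theta (e.symm (e x)))
    rw [e.symm_apply_apply]

end PostHopfAlgebroid

end Transport

/-! ### Base change of universal enveloping algebras -/

namespace UniversalEnvelopingAlgebra

variable {k R g : Type*} [CommRing k] [CommRing R] [Algebra k R] [LieRing g] [LieAlgebra k g]

/-- A linear map that takes brackets to commutators as a homomorphism of Lie algebras. -/
def lieHomOfCommutator {L B : Type*} [LieRing L] [LieAlgebra R L] [Ring B] [Algebra R B]
    (f : L →ₗ[R] B) (h : ∀ x y, f ⁅x, y⁆ = f x * f y - f y * f x) : L →ₗ⁅R⁆ B :=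
  { f with map_lie' := fun {x y} => h x y }

/-- The algebra homomorphism `U_R(R ⊗ g) → R ⊗ U(g)` with `f ⊗ x ↦ f ⊗ x`. -/
def toTensor : UniversalEnvelopingAlgebra R (R ⊗[k] g) →ₐ[R]
    R ⊗[k] UniversalEnvelopingAlgebra k g :=
  lift R (lieHomOfCommutator
    (LinearMap.baseChange R ((ι k : g →ₗ⁅k⁆ UniversalEnvelopingAlgebra k g) : g →ₗ[k] _))
    (fun x y => by
      induction x with
      | zero => simp
      | add x x' hx hx' =>
        rw [add_lie, map_add, hx, hx', map_add, add_mul, mul_add, add_sub_add_comm]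
      | tmul a x =>
        induction y with
        | zero => simp
        | add y y' hy hy' =>
          rw [lie_add, map_add, hy, hy', map_add, add_mul, mul_add, add_sub_add_comm]
        | tmul b y =>
          simp only [LieAlgebra.ExtendScalars.bracket_tmul, LinearMap.baseChange_tmul,
            LieHom.coe_toLinearMap, LieHom.map_lie, LieRing.of_associative_ring_bracket,
            Algebra.TensorProduct.tmul_mul_tmul, TensorProduct.tmul_sub, mul_comm b]))

theorem toTensor_ι_tmul (f : R) (x : g) : toTensor (ι R (f ⊗ₜ[k] x)) = f ⊗ₜ[k] ι k x := by
  rw [toTensor, lift_ι_apply]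
  exact LinearMap.baseChange_tmul _ _ _

/-- The algebra homomorphism `U(g) → U_R(R ⊗ g)` with `x ↦ 1 ⊗ x`. -/
def toBaseChange : UniversalEnvelopingAlgebra k g →ₐ[k]
    UniversalEnvelopingAlgebra R (R ⊗[k] g) :=
  lift k
    { toFun := fun x => ι R ((1 : R) ⊗ₜ[k] x)
      map_add' := fun x y => by rw [TensorProduct.tmul_add, map_add]
      map_smul' := fun c x => by
        rw [TensorProduct.tmul_smul, ← algebraMap_smul R c, map_smul, algebraMap_smul]
        rfl
      map_lie' := fun {x y} => by
        rw [← LieHom.map_lie, LieAlgebra.ExtendScalars.bracket_tmul, one_mul] }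

theorem toBaseChange_ι (x : g) :
    toBaseChange (R := R) (ι k x) = ι R ((1 : R) ⊗ₜ[k] x) := by
  rw [toBaseChange, lift_ι_apply]
  rfl

/-- The algebra homomorphism `R ⊗ U(g) → U_R(R ⊗ g)` with `f ⊗ x ↦ f ⊗ x`. -/
def ofTensor : R ⊗[k] UniversalEnvelopingAlgebra k g →ₐ[R]
    UniversalEnvelopingAlgebra R (R ⊗[k] g) :=
  Algebra.TensorProduct.lift (Algebra.ofId R _) toBaseChange
    (fun f _ => Algebra.commutes f _)

theorem ofTensor_tmul (f : R) (a : UniversalEnvelopingAlgebra k g) :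
    ofTensor (f ⊗ₜ[k] a) = algebraMap R _ f * toBaseChange a :=
  Algebra.TensorProduct.lift_tmul _ _ _ _ _

theorem ofTensor_one_tmul_ι (x : g) :
    ofTensor ((1 : R) ⊗ₜ[k] ι k x) = ι R ((1 : R) ⊗ₜ[k] x) := by
  rw [ofTensor_tmul, map_one, one_mul, toBaseChange_ι]

theorem toTensor_toBaseChange (a : UniversalEnvelopingAlgebra k g) :
    toTensor (toBaseChange a) = (1 : R) ⊗ₜ[k] a := by
  induction a using word_induction with
  | scalar r =>
    rw [AlgHom.commutes, IsScalarTower.algebraMap_apply k R, AlgHom.commutes,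
      Algebra.TensorProduct.algebraMap_apply, Algebra.algebraMap_self_apply,
      Algebra.algebraMap_eq_smul_one, Algebra.algebraMap_eq_smul_one, TensorProduct.smul_tmul]
  | add a b ha hb => rw [map_add, map_add, ha, hb, TensorProduct.tmul_add]
  | mul x a ha =>
    rw [map_mul, map_mul, ha, toBaseChange_ι, toTensor_ι_tmul,
      Algebra.TensorProduct.tmul_mul_tmul, one_mul]

/-- The isomorphism of algebras `U_R(R ⊗ g) ≃ R ⊗ U(g)`. -/
def tensorAlgEquiv : UniversalEnvelopingAlgebra R (R ⊗[k] g) ≃ₐ[R]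
    R ⊗[k] UniversalEnvelopingAlgebra k g :=
  AlgEquiv.ofAlgHom toTensor ofTensor
    (by
      refine AlgHom.ext fun z => ?_
      show toTensor (ofTensor z) = z
      induction z with
      | zero => simp
      | add z w hz hw => rw [map_add, map_add, hz, hw]
      | tmul f a =>
        rw [ofTensor_tmul, map_mul, AlgHom.commutes, toTensor_toBaseChange, ← Algebra.smul_def,
          TensorProduct.smul_tmul', smul_eq_mul, mul_one])
    (algHom_ext' fun x => by
      show ofTensor (toTensor (ι R x)) = ι R x
      induction x with
      | zero => simp
      | add x y hx hy => simp only [map_add, hx, hy]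
      | tmul f x =>
        rw [toTensor_ι_tmul, ofTensor_tmul, toBaseChange_ι, ← Algebra.smul_def, ← map_smul,
          TensorProduct.smul_tmul', smul_eq_mul, mul_one])

variable (k R g) in
/-- The isomorphism of bialgebras `U_R(R ⊗ g) ≃ R ⊗ U(g)`. -/
def tensorEquiv : UniversalEnvelopingAlgebra R (R ⊗[k] g) ≃ₐc[R]
    R ⊗[k] UniversalEnvelopingAlgebra k g :=
  BialgEquiv.ofAlgEquiv tensorAlgEquiv
    (algHom_ext' fun x => by
      show counit (R := R) (toTensor (ι R x)) = counit (R := R) (ι R x)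
      rw [counit_eq R (ι R x), counitHom_ι]
      induction x with
      | zero => simp
      | add x y hx hy => rw [map_add, map_add, map_add, hx, hy, add_zero]
      | tmul f x =>
        rw [toTensor_ι_tmul, PostLieAlgebra.counit_tmul', counit_eq, counitHom_ι, zero_smul])
    (algHom_ext' fun x => by
      show Algebra.TensorProduct.map toTensor toTensor (comul (R := R) (ι R x)) =
        comul (R := R) (toTensor (ι R x))
      rw [comul_ι, map_add, Algebra.TensorProduct.map_tmul, Algebra.TensorProduct.map_tmul,
        map_one]
      induction x with
      | zero => simp
      | add x y hx hy =>
        rw [map_add, map_add, map_add, ← hx, ← hy, TensorProduct.add_tmul, TensorProduct.tmul_add]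
        abel
      | tmul f x =>
        -- The second term of the coproduct appears as `(f ⊗ 1) ⊗ (1 ⊗ x)`; moving `f` across the
        -- tensor product over `R` shows that `f ⊗ x` is primitive.
        rw [toTensor_ι_tmul, PostLieAlgebra.comul_tmul_eq_sum (Sweedler.ofPrimitive (comul_ι x)),
          Sweedler.sum_ofPrimitive (comul_ι x)
            (fun a b => (f ⊗ₜ[k] a) ⊗ₜ[R] ((1 : R) ⊗ₜ[k] b)),
          PostLieAlgebra.tensor_eq_smul f 1, TensorProduct.smul_tmul, ←
          PostLieAlgebra.tensor_eq_smul]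
        rfl)

theorem tensorEquiv_ι_tmul (f : R) (x : g) :
    (tensorEquiv k R g) (ι R (f ⊗ₜ[k] x)) = f ⊗ₜ[k] ι k x := toTensor_ι_tmul f x

theorem tensorEquiv_symm_one_tmul_ι (x : g) :
    (tensorEquiv k R g).symm ((1 : R) ⊗ₜ[k] ι k x) = ι R ((1 : R) ⊗ₜ[k] x) := ofTensor_one_tmul_ι x

end UniversalEnvelopingAlgebra

/-- For a primitive `x` the axioms `tri_mul` and `tri_tri` have two summands each, and with `1 ▷ y =
y` they are the two recursion rules. Only the values on generators have to be supplied. -/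
theorem WeakPostHopfAlgebroid.isEnvelopingProduct {k R L : Type*} [CommRing k] [CommRing R]
    [Algebra k R] [LieRing L] [LieAlgebra R L] [Module k L] [IsScalarTower k R L]
    [Algebra k (UniversalEnvelopingAlgebra R L)] [IsScalarTower k R (UniversalEnvelopingAlgebra R L)]
    (W : WeakPostHopfAlgebroid k R (UniversalEnvelopingAlgebra R L)) (Q : PostLieRinehart k R L)
    (tri_base : ∀ (x : L) (f : R), W.tri (ι R x) (algebraMap R _ f) =
      algebraMap R _ (Q.anchor x f))
    (tri_ι : ∀ x y : L, W.tri (ι R x) (ι R y) = ι R (Q.tri x y)) :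
    Q.IsEnvelopingProduct fun X Y => W.tri X Y where
  base_tri f X := by
    show W.tri _ X = _
    rw [Algebra.algebraMap_eq_smul_one, W.smul_tri, W.one_tri, smul_one_mul]
  tri_base := tri_base
  tri_ι := tri_ι
  tri_mul x y X := by
    have h := UniversalEnvelopingAlgebra.comul_ι (k := R) x
    refine (W.tri_mul _ _ _ (Sweedler.ofPrimitive h)).trans
      ((Sweedler.sum_ofPrimitive h fun a b => W.tri a (ι R y) * W.tri b X).trans ?_)
    simp only [W.one_tri, tri_ι]
  mul_tri x X Y := by
    have h := UniversalEnvelopingAlgebra.comul_ι (k := R) x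
    have h' := W.tri_tri (ι R x) X Y (Sweedler.ofPrimitive h)
    rw [Sweedler.sum_ofPrimitive h fun a b => a * W.tri b X, W.one_tri, one_mul, map_add,
      LinearMap.add_apply] at h'
    exact eq_sub_of_add_eq h'.symm

namespace PostLieAlgebra

variable {k R g : Type*} [CommRing k] [CommRing R] [Algebra k R] [LieRing g] [LieAlgebra k g]
  (P : PostLieAlgebra k g) (ρ : P.SubAdjacent →ₗ⁅k⁆ Derivation k R R)

/-- The post-Hopf algebroid `U_R(R ⊗ g)`. -/
def envelopingAlgebroid : PostHopfAlgebroid k R (UniversalEnvelopingAlgebra R (R ⊗[k] g)) :=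
  (P.actionAlgebroid ρ).transport (UniversalEnvelopingAlgebra.tensorEquiv k R g).symm

theorem envelopingAlgebroid_tri (X Y) : (P.envelopingAlgebroid ρ).tri X Y =
    (UniversalEnvelopingAlgebra.tensorEquiv k R g).symm (P.hat (P.actH ρ)
      ((UniversalEnvelopingAlgebra.tensorEquiv k R g) X) ((UniversalEnvelopingAlgebra.tensorEquiv k R g) Y)) := rfl

theorem isEnvelopingProduct_envelopingAlgebroid :
    (actionPostLieRinehart P ρ).IsEnvelopingProduct
      fun X Y => (P.envelopingAlgebroid ρ).tri X Y := by
  refine WeakPostHopfAlgebroid.isEnvelopingProduct _ _ (fun X f => ?_) (fun X Y => ?_)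
  · apply EquivLike.injective (UniversalEnvelopingAlgebra.tensorEquiv k R g)
    rw [envelopingAlgebroid_tri, BialgEquiv.apply_symm_apply,
      AlgHomClass.commutes (UniversalEnvelopingAlgebra.tensorEquiv k R g),
      AlgHomClass.commutes (UniversalEnvelopingAlgebra.tensorEquiv k R g), Algebra.TensorProduct.algebraMap_apply,
      Algebra.TensorProduct.algebraMap_apply, Algebra.algebraMap_self_apply,
      Algebra.algebraMap_self_apply]
    induction X with
    | zero => simp
    | add X Y hX hY =>
      simp only [map_add, LinearMap.add_apply, hX, hY, Derivation.add_apply,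
        TensorProduct.add_tmul]
    | tmul f' x =>
      obtain ⟨x, rfl⟩ := P.ofSub.surjective x
      rw [UniversalEnvelopingAlgebra.tensorEquiv_ι_tmul, ← oudomGuin_ι, hat_tmul, actH_tmul_one,
        liftDer_ι, TensorProduct.smul_tmul']
      exact congrArg (· ⊗ₜ[k] 1) (actionAnchor_tmul P ρ f' f (P.ofSub x)).symm
  · apply EquivLike.injective (UniversalEnvelopingAlgebra.tensorEquiv k R g)
    rw [envelopingAlgebroid_tri, BialgEquiv.apply_symm_apply]
    show _ = (UniversalEnvelopingAlgebra.tensorEquiv k R g) (ι R (actionTri P ρ X Y))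
    induction X with
    | zero => simp
    | add X X' hX hX' => simp only [map_add, LinearMap.add_apply, hX, hX']
    | tmul f x =>
      induction Y with
      | zero => simp
      | add Y Y' hY hY' => simp only [map_add, hY, hY']
      | tmul f' y =>
        obtain ⟨x, rfl⟩ := P.ofSub.surjective x
        rw [actionTri_tmul, map_add, map_add, UniversalEnvelopingAlgebra.tensorEquiv_ι_tmul,
          UniversalEnvelopingAlgebra.tensorEquiv_ι_tmul,
          UniversalEnvelopingAlgebra.tensorEquiv_ι_tmul,
          UniversalEnvelopingAlgebra.tensorEquiv_ι_tmul, ← oudomGuin_ι, hat_tmul, actH_ι_tmul,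
          derLin_ι, smul_add, TensorProduct.smul_tmul', TensorProduct.smul_tmul',
          LinearEquiv.symm_apply_apply]
        rfl

end PostLieAlgebra

end

theorem mainTheorem7 {k R g : Type*} [Field k] [IsAlgClosed k] [CharZero k]
    [CommRing R] [Algebra k R] [LieRing g] [LieAlgebra k g]
    (P : PostLieAlgebra k g) (ρ : P.SubAdjacent →ₗ⁅k⁆ Derivation k R R) :
    -- the post-Hopf algebra `(U(g), ▷)`, whose product is the only one given by the recursion
    ∃ A : PostHopfAlgebra k (UniversalEnvelopingAlgebra k g),
      P.toPostLieRinehart.IsEnvelopingProduct (fun X Y => A.tri X Y) ∧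
      (∀ t : UniversalEnvelopingAlgebra k g →ₗ[k] UniversalEnvelopingAlgebra k g →ₗ[k]
          UniversalEnvelopingAlgebra k g,
        P.toPostLieRinehart.IsEnvelopingProduct (fun X Y => t X Y) → t = A.tri) ∧
    -- the action of `U(g)_▷` on `R` and the action post-Hopf algebroid `R ⊗ U(g)`
    ∃ Φ : OudomGuinIso P A,
      A.IsModuleAlgebra (Φ.act ρ) ∧
    ∃ H : PostHopfAlgebroid k R (R ⊗[k] UniversalEnvelopingAlgebra k g),
      H.IsAction A (Φ.act ρ) ∧
    -- the universal enveloping algebra of the action post-Lie-Rinehart algebra `R ⊗ g`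
    ∃ Q : PostHopfAlgebroid k R (UniversalEnvelopingAlgebra R (R ⊗[k] g)),
      (actionPostLieRinehart P ρ).IsEnvelopingProduct (fun X Y => Q.tri X Y) ∧
      (∀ t : UniversalEnvelopingAlgebra R (R ⊗[k] g) →ₗ[k]
          UniversalEnvelopingAlgebra R (R ⊗[k] g) →ₗ[k] UniversalEnvelopingAlgebra R (R ⊗[k] g),
        (actionPostLieRinehart P ρ).IsEnvelopingProduct (fun X Y => t X Y) → t = Q.tri) ∧
    ∃ Ψ : H.Iso Q,
      ∀ x : g, Ψ.equiv (1 ⊗ₜ[k] ι k x) = ι R ((1 : R) ⊗ₜ[k] x) :=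

  ⟨P.postHopfAlgebra, P.isEnvelopingProduct_postHopfAlgebra,
    fun _ ht => ht.unique P.isEnvelopingProduct_postHopfAlgebra,
    P.oudomGuinIso, P.isModuleAlgebra ρ, P.actionAlgebroid ρ, P.isAction_actionAlgebroid ρ,
    P.envelopingAlgebroid ρ, P.isEnvelopingProduct_envelopingAlgebroid ρ,
    fun _ ht => ht.unique (P.isEnvelopingProduct_envelopingAlgebroid ρ),
    (P.actionAlgebroid ρ).isoTransport (UniversalEnvelopingAlgebra.tensorEquiv k R g).symm,
    UniversalEnvelopingAlgebra.tensorEquiv_symm_one_tmul_ι⟩
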